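/- All gradings are by abelian groups. A $G$-grading on a real algebra $\mathcal{A}$ is a direct sum decomposition $\mathcal{A}=\bigoplus_{g\in G}\mathcal{A}_g$ into subspaces with $\mathcal{A}_g\mathcal{A}_h\subset\mathcal{A}_{gh}$ for all $g,h\in G$; a grading on an algebra with involution $(\mathcal{A},\varphi)$ is required, in addition, to satisfy $\varphi(\mathcal{A}_g)\subset\mathcal{A}_g$ for all $g$. An $H$-grading $\{\mathcal{A}'_h\}_{h\in H}$ is a refinement of a $G$-grading $\{\mathcal{A}_g\}_{g\in G}$ if every $\mathcal{A}'_h$ is contained in some $\mathcal{A}_g$; it is proper if this inclusion is strict for at least one $h$ with $\mathcal{A}'_h\ne 0$. A grading on an algebra (respectively, on an algebra with involution) is fine if it has no proper refinement among the gradings by abelian groups on that algebra (respectively, on that algebra with involution). Theorem. Let $G$ be an abelian group and let $\mathcal{D}$ be a finite-dimensional $G$-graded-division algebra over $\mathbb{R}$, i.e., a nonzero finite-dimensional unital associative $G$-graded real algebra in which every nonzero homogeneous element is invertible. Let $\mathcal{V}$ be a nonzero $G$-graded right $\mathcal{D}$-module of finite rank, and let $\mathcal{R}=\mathrm{End}_{\mathcal{D}}(\mathcal{V})$,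 with the induced $G$-grading $\mathcal{R}_g=\{r\in\mathcal{R}\mid r\mathcal{V}_h\subset\mathcal{V}_{gh}\text{ for all }h\in G\}$. Let $\varphi$ be a degree-preserving involution of $\mathcal{R}$, i.e., an $\mathbb{R}$-linear involutive antiautomorphism with $\varphi(\mathcal{R}_g)\subset\mathcal{R}_g$ for all $g\in G$. Assume that $(\mathcal{R},\varphi)$ is central simple as an algebra with involution, i.e., $0$ and $\mathcal{R}$ are the only two-sided ideals of $\mathcal{R}$ invariant under $\varphi$, and the only elements $z$ of the center of $\mathcal{R}$ with $\varphi(z)=z$ are the real multiples of $1$. If the grading on $(\mathcal{R},\varphi)$ is fine, then the grading on $\mathcal{D}$ is fine. -/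

import Mathlib

/-! Gradings by abelian groups (written additively) on modules, associative algebras, and
associative algebras with involution; refinements and fine gradings; graded-division algebras,
graded right modules over them and the induced grading on the endomorphism algebra. -/

namespace GradedInv

section Gradings

variable {F : Type*} [Field F] {G : Type*} [AddCommGroup G] {H : Type*} [AddCommGroup H]

/-- A `G`-grading on a unital associative `F`-algebra `A`: a direct sum decomposition
`A = ⨁ g, 𝒜 g` into subspaces (an independent family with sum `A`) such
that `𝒜 g * 𝒜 h ⊆ 𝒜 (g + h)`. -/
structure IsAlgebraGrading {A : Type*} [Ring A] [Algebra F A] (𝒜 : G → Submodule F A) : Prop where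
  independent : iSupIndep 𝒜
  iSup_eq_top : ⨆ g, 𝒜 g = ⊤
  mul_mem : ∀ ⦃g h : G⦄ ⦃x y : A⦄, x ∈ 𝒜 g → y ∈ 𝒜 h → x * y ∈ 𝒜 (g + h)

/-- A map preserves degrees if it leaves every homogeneous component invariant. -/
def PreservesDegree {A : Type*} [AddCommGroup A] [Module F A] (𝒜 : G → Submodule F A)
    (φ : A →ₗ[F] A) : Prop :=
  ∀ (g : G) (x : A), x ∈ 𝒜 g → φ x ∈ 𝒜 g

/-- The `H`-grading `ℬ` refines the `G`-grading `𝒜`: every component of `ℬ` is contained in some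
component of `𝒜`. -/
def IsRefinement {A : Type*} [AddCommGroup A] [Module F A] (ℬ : H → Submodule F A)
    (𝒜 : G → Submodule F A) : Prop :=
  ∀ h : H, ∃ g : G, ℬ h ≤ 𝒜 g

/-- A refinement is proper if the inclusion is proper for some `h` in the support of `ℬ`. -/
def IsProperRefinement {A : Type*} [AddCommGroup A] [Module F A] (ℬ : H → Submodule F A)
    (𝒜 : G → Submodule F A) : Prop :=
  IsRefinement ℬ 𝒜 ∧ ∃ (h : H) (g : G), ℬ h ≠ ⊥ ∧ ℬ h < 𝒜 g

end Gradings

section Fine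

universe u

/-- A grading `𝒜` on the algebra `A` is fine if no grading on `A` by an abelian group is a proper
refinement of it. The refining groups are taken in the universe of `G`; for a finite-dimensional
`A` this is no restriction, as a grading only involves the finitely generated subgroup generated by
its support, which has a copy in every universe. -/
def IsFine {F : Type*} [Field F] {G : Type u} [AddCommGroup G] {A : Type*} [Ring A] [Algebra F A]
    (𝒜 : G → Submodule F A) : Prop :=
  ∀ (H : Type u) [AddCommGroup H] (ℬ : H → Submodule F A),
    IsAlgebraGrading ℬ → ¬ IsProperRefinement ℬ 𝒜

/-- A grading `𝒜` on the algebra with involution `(A, φ)` is fine if no grading on `(A, φ)` (that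
is, no grading on `A` whose components are `φ`-invariant) by an abelian group is a
proper refinement of it. -/
def IsFineWithInvolution {F : Type*} [Field F] {G : Type u} [AddCommGroup G] {A : Type*} [Ring A]
    [Algebra F A] (φ : A →ₗ[F] A) (𝒜 : G → Submodule F A) : Prop :=
  ∀ (H : Type u) [AddCommGroup H] (ℬ : H → Submodule F A),
    IsAlgebraGrading ℬ → PreservesDegree ℬ φ → ¬ IsProperRefinement ℬ 𝒜

end Fine

section Involutions

variable {F : Type*} [Field F] {A : Type*} [Ring A] [Algebra F A]

/-- An involution of the `F`-algebra `A`: an `F`-linear antiautomorphism of order at most `2`. -/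
structure IsInvolution (φ : A →ₗ[F] A) : Prop where
  map_mul : ∀ x y : A, φ (x * y) = φ y * φ x
  involutive : ∀ x : A, φ (φ x) = x

/-- `(A, φ)` is central simple as an algebra with involution: `A` is nonzero, the only two-sided
ideals of `A` invariant under `φ` are `0` and `A`, and the only symmetric elements of the centre
are the scalars. -/
structure IsCentralSimpleWithInvolution (φ : A →ₗ[F] A) : Prop where
  nontrivial : Nontrivial A
  simple : ∀ I : TwoSidedIdeal A, (∀ x ∈ I, φ x ∈ I) → I = ⊥ ∨ I = ⊤
  central : ∀ x ∈ Subalgebra.center F A, φ x = x → ∃ c : F, x = algebraMap F A c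

end Involutions

section GradedDivision

variable {F : Type*} [Field F] {G : Type*} [AddCommGroup G]

/-- `D`, with the grading `𝒟`, is a graded-division algebra: every nonzero homogeneous element is
invertible. -/
structure IsGradedDivision {D : Type*} [Ring D] [Algebra F D] (𝒟 : G → Submodule F D) : Prop where
  nontrivial : Nontrivial D
  isGrading : IsAlgebraGrading 𝒟
  isUnit : ∀ (g : G) (d : D), d ∈ 𝒟 g → d ≠ 0 → IsUnit d

variable {D : Type*} [Ring D] [Algebra F D]
  {V : Type*} [AddCommGroup V] [Module F V] [Module Dᵐᵒᵖ V] [IsScalarTower F Dᵐᵒᵖ V]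

/-- A grading on the right `D`-module `V` (a left module over `Dᵐᵒᵖ`, with `v d` written
`MulOpposite.op d • v`): `V = ⨁ g, 𝒱 g` and `𝒱 g · 𝒟 h ⊆ 𝒱 (g + h)`. -/
structure IsRightModuleGrading (𝒟 : G → Submodule F D) (𝒱 : G → Submodule F V) : Prop where
  independent : iSupIndep 𝒱
  iSup_eq_top : ⨆ g, 𝒱 g = ⊤
  smul_mem : ∀ ⦃g h : G⦄ ⦃v : V⦄ ⦃d : D⦄, v ∈ 𝒱 g → d ∈ 𝒟 h → MulOpposite.op d • v ∈ 𝒱 (g + h)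

/-- The grading on `End_D(V)` induced by a grading on `V`: the component of degree `g` consists of
the `D`-linear maps `f` with `f (𝒱 h) ⊆ 𝒱 (g + h)` for all `h`. -/
def endGrading (D : Type*) [Ring D] [Algebra F D] [Module Dᵐᵒᵖ V] [IsScalarTower F Dᵐᵒᵖ V]
    (𝒱 : G → Submodule F V) (g : G) : Submodule F (Module.End Dᵐᵒᵖ V) where
  carrier := {f | ∀ (h : G) (v : V), v ∈ 𝒱 h → f v ∈ 𝒱 (g + h)}
  add_mem' := fun ha hb h v hv => (𝒱 (g + h)).add_mem (ha h v hv) (hb h v hv)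
  zero_mem' := fun h _ _ => (𝒱 (g + h)).zero_mem
  smul_mem' := fun c _ hf h v hv => (𝒱 (g + h)).smul_mem c (hf h v hv)

end GradedDivision

end GradedInv

/-!
# Fine gradings on real algebras with involution

The proof is by contraposition: a proper refinement of the grading on `D` is turned into a proper
refinement of the grading on `(R, φ)`, where `R = End_D(V)`.

*The involution as a form.* The image under `φ` of a homogeneous projection of `V` onto a line is
again such a projection. Comparing the two lines produces a nondegenerate graded form `B` on `V`,
hermitian or skew-hermitian with respect to a degree-preserving involution `σ` of `D`, whose
adjunction is `φ` (`exists_isHermitianForm`). The centrality of `(R, φ)` says that symmetric central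
elements of `D` of degree `0` are real (`IsHermitianForm.central`).

*Adapted refinements of `D`.* It does not suffice to refine the grading on `D`: the components of
the refinement have to be `σ`-invariant, and the symmetric and skew homogeneous elements `p` of `D`
have to become homogeneous for the refinement after a change `p ↦ σ d * p * d` with `d` in the
identity component `D₀` (`IsAdaptedRefinement`). Since homogeneous elements are invertible, a proper
refinement has to refine `D₀`, which therefore contains a square root `J` of `-1`. An adapted
refinement is found as follows.

* If `D₀` is not commutative, it contains a skew square root of `-1`, and conjugation by it splits
  the components of `D` into eigenspaces. All square roots of `-1` in `D₀` are conjugate, so that a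
  square root of `-1` that is skew for the involution twisted by `p` can be moved to the given one
  (`IsGradedDivision.exists_adapted_of_noncomm`).
* If `D₀ = ℝ + ℝ J` is not central in `D`, the given refinement works after conjugation by an
  element of `D₀` (`IsRefinement.exists_adapted_of_not_central`): a nonzero homogeneous element `z`
  of the refinement that anticommutes with `J` can be made symmetric or skew, and then for each
  homogeneous `x` of the refinement one of `x` and `x * z` induces on `D₀` the same map as `σ`, so
  that it is symmetric or skew.
* If `D₀ = ℝ + ℝ J` is central in `D`, centrality gives `σ J = -J`. As `D` has a refinement with
  real identity component, its homogeneous elements commute up to real factors, products of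
  symmetric or skew elements are symmetric or skew, and the decomposition of the components of `D`
  into symmetric and skew elements is a grading (`IsGradedDivision.exists_adapted_of_central`).

*From `D` to `R`.* Orthogonalization with anisotropic vectors and hyperbolic pairs gives a
homogeneous basis of `V` whose Gram matrix is monomial, and because the refinement is adapted, the
nonzero entries can be taken homogeneous for it (`IsHermitianForm.exists_monomial_basis`). After an
embedding of the grading group into one in which elements can be halved
(`exists_injective_halvable`), the vectors of the basis are given half of the degrees of the entries
of the Gram matrix. The form is then graded, and the matrix units of this basis define a grading of
`R` that is preserved by `φ` and properly refines the given one
(`IsHermitianForm.exists_properRefinement`). Its grading group can be replaced by one in the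
universe of `G` (`IsFineWithInvolution.not_isProperRefinement`).
-/

namespace GradedInv

/-! ### Homogeneous components -/

section Components

variable {F M ι : Type*} [Field F] [AddCommGroup M] [Module F M] {𝒜 : ι → Submodule F M}

/-- The projections of an internal direct sum onto its components. -/
theorem exists_projections (hi : iSupIndep 𝒜) (ht : ⨆ i, 𝒜 i = ⊤) :
    ∃ P : ι → M →ₗ[F] M, (∀ i x, P i x ∈ 𝒜 i) ∧ (∀ i x, x ∈ 𝒜 i → P i x = x) ∧
      (∀ i j x, x ∈ 𝒜 i → j ≠ i → P j x = 0) ∧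
      ∀ x, ∃ s : Finset ι, x = ∑ i ∈ s, P i x := by
  classical
  have hint := DirectSum.isInternal_submodule_of_iSupIndep_of_iSup_eq_top hi ht
  let _ := hint.chooseDecomposition
  refine ⟨fun i => (𝒜 i).subtype ∘ₗ DirectSum.component F ι (fun i => 𝒜 i) i ∘ₗ
    (DirectSum.decomposeLinearEquiv 𝒜).toLinearMap, fun i x => ?_, fun i x hx => ?_,
    fun i j x hx hij => ?_, fun x => ?_⟩
  · simp
  · change ((DirectSum.decompose 𝒜 x i : 𝒜 i) : M) = x
    exact DirectSum.decompose_of_mem_same 𝒜 hx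
  · change ((DirectSum.decompose 𝒜 x j : 𝒜 j) : M) = 0
    exact DirectSum.decompose_of_mem_ne 𝒜 hx hij.symm
  · exact ⟨_, (DirectSum.sum_support_decompose 𝒜 x).symm⟩

theorem eq_zero_of_iSupIndep (hi : iSupIndep 𝒜) {i j : ι} (hij : i ≠ j) {x : M}
    (h₁ : x ∈ 𝒜 i) (h₂ : x ∈ 𝒜 j) : x = 0 := by
  have := hi.pairwiseDisjoint hij
  exact (Submodule.disjoint_def.1 this) x h₁ h₂

/-- A property that holds on the components of a direct sum and is additive holds everywhere. -/
theorem induction_of_iSup_eq_top (ht : ⨆ i, 𝒜 i = ⊤) {p : M → Prop}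
    (hp : ∀ i, ∀ x ∈ 𝒜 i, p x) (h0 : p 0) (hadd : ∀ x y, p x → p y → p (x + y)) (x : M) : p x :=
  Submodule.iSup_induction 𝒜 (motive := p) (by rw [ht]; trivial) hp h0 hadd

/-- A family of subspaces is independent if for each member there is a linear map that is
injective on it and vanishes on the other members. -/
theorem iSupIndep_of_separating {N : Type*} [AddCommGroup N] [Module F N]
    (h : ∀ i, ∃ L : M →ₗ[F] N, (∀ x ∈ 𝒜 i, L x = 0 → x = 0) ∧
      ∀ j, j ≠ i → ∀ x ∈ 𝒜 j, L x = 0) : iSupIndep 𝒜 := by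
  rw [iSupIndep_iff_finsetSum_eq_zero_imp_eq_zero]
  intro s v hv hs i hi
  obtain ⟨L, h1, h2⟩ := h i
  refine h1 _ (hv i hi) ?_
  have h3 : ∑ j ∈ s, L (v j) = 0 := by rw [← map_sum, hs, map_zero]
  rwa [Finset.sum_eq_single_of_mem i hi fun j hj hji => h2 j hji _ (hv j hj)] at h3

end Components

/-! ### Gradings on algebras -/

section AlgebraGrading

variable {F A G : Type*} [Field F] [Ring A] [Algebra F A] [AddCommGroup G] {𝒜 : G → Submodule F A}

theorem IsAlgebraGrading.one_mem (h : IsAlgebraGrading 𝒜) : (1 : A) ∈ 𝒜 0 := by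
  obtain ⟨P, hP, hP1, hP2, -⟩ := exists_projections h.independent h.iSup_eq_top
  -- the component of degree `0` of `1` is a left unit on homogeneous elements
  have key : ∀ x, P 0 1 * x = x := by
    refine induction_of_iSup_eq_top h.iSup_eq_top (fun g x hx => ?_) (by simp)
      (fun x y hx hy => by rw [mul_add, hx, hy])
    have h1 : ∀ y, P g (y * x) = P 0 y * x := by
      refine induction_of_iSup_eq_top h.iSup_eq_top (fun k y hy => ?_) (by simp)
        (fun y z hy hz => by rw [add_mul, map_add, hy, hz, map_add, add_mul])
      by_cases hk : k = 0
      · subst hk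
        have := h.mul_mem hy hx
        rw [zero_add] at this
        rw [hP1 _ _ this, hP1 _ _ hy]
      · rw [hP2 (k + g) g _ (h.mul_mem hy hx) (fun e => hk (by simpa using e.symm)),
          hP2 k 0 _ hy (Ne.symm hk), zero_mul]
    rw [← h1, one_mul, hP1 _ _ hx]
  have := key 1
  rw [mul_one] at this
  rw [← this]
  exact hP _ _

theorem IsAlgebraGrading.algebraMap_mem (h : IsAlgebraGrading 𝒜) (c : F) :
    algebraMap F A c ∈ 𝒜 0 := by
  rw [Algebra.algebraMap_eq_smul_one]
  exact (𝒜 0).smul_mem _ h.one_mem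

/-- A right inverse of a homogeneous unit is homogeneous of opposite degree. -/
theorem IsAlgebraGrading.inv_mem (h : IsAlgebraGrading 𝒜) {g : G} {x y : A} (hx : x ∈ 𝒜 g)
    (hxy : x * y = 1) (hyx : y * x = 1) : y ∈ 𝒜 (-g) := by
  obtain ⟨P, hP, hP1, hP2, -⟩ := exists_projections h.independent h.iSup_eq_top
  have h1 : ∀ y, P 0 (x * y) = x * P (-g) y := by
    refine induction_of_iSup_eq_top h.iSup_eq_top (fun k y hy => ?_) (by simp)
      (fun y z hy hz => by rw [mul_add, map_add, hy, hz, map_add, mul_add])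
    by_cases hk : k = -g
    · subst hk
      have := h.mul_mem hx hy
      rw [add_neg_cancel] at this
      rw [hP1 _ _ this, hP1 _ _ hy]
    · rw [hP2 (g + k) 0 _ (h.mul_mem hx hy) (fun h0 => hk (by
        rw [eq_neg_iff_add_eq_zero, add_comm]; exact h0.symm)), hP2 k _ _ hy (Ne.symm hk), mul_zero]
  have h2 := h1 y
  rw [hxy, hP1 _ _ h.one_mem] at h2
  have : y = P (-g) y := by
    calc y = y * (x * P (-g) y) := by rw [← h2, mul_one]
      _ = P (-g) y := by rw [← mul_assoc, hyx, one_mul]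
  rw [this]
  exact hP _ _

/-- If each component of a grading `ℬ` lies in a component of `𝒜`, then the components with
respect to `ℬ` of an element of `𝒜 g` lie in `𝒜 g`. -/
theorem IsRefinement.exists_projections {M H G : Type*} [AddCommGroup M] [Module F M]
    [AddCommGroup G] [AddCommGroup H]
    {𝒜 : G → Submodule F M} {ℬ : H → Submodule F M} (hr : IsRefinement ℬ 𝒜)
    (hi : iSupIndep ℬ) (ht : ⨆ i, ℬ i = ⊤) (hi' : iSupIndep 𝒜) :
    ∃ P : H → M →ₗ[F] M, (∀ i x, P i x ∈ ℬ i) ∧ (∀ i x, x ∈ ℬ i → P i x = x) ∧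
      (∀ i j x, x ∈ ℬ i → j ≠ i → P j x = 0) ∧
      (∀ x, ∃ s : Finset H, x = ∑ i ∈ s, P i x) ∧ ∀ g i x, x ∈ 𝒜 g → P i x ∈ 𝒜 g := by
  classical
  obtain ⟨P, hP, hP1, hP2, hP3⟩ := GradedInv.exists_projections hi ht
  refine ⟨P, hP, hP1, hP2, hP3, fun g i x hx => ?_⟩
  choose γ hγ using hr
  have ht' : ⨆ g, 𝒜 g = ⊤ := by
    rw [eq_top_iff, ← ht]
    exact iSup_le fun i => (hγ i).trans (le_iSup _ _)
  obtain ⟨Q, hQ, hQ1, hQ2, -⟩ := GradedInv.exists_projections hi' ht'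
  have h1 : ∀ x, Q g (P i x) = P i (Q g x) := by
    refine induction_of_iSup_eq_top ht (fun k y hy => ?_) (by simp)
      (fun y z hy hz => by simp only [map_add, hy, hz])
    by_cases hg : g = γ k
    · rw [hg, hQ1 _ y (hγ _ hy)]
      by_cases hk : i = k
      · rw [hk, hP1 _ _ hy, hQ1 _ y (hγ _ hy)]
      · rw [hP2 k i _ hy hk, map_zero]
    · rw [hQ2 _ g y (hγ _ hy) hg, map_zero]
      by_cases hk : i = k
      · rw [hk, hP1 _ _ hy, hQ2 _ g y (hγ _ hy) hg]
      · rw [hP2 k i _ hy hk, map_zero]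
  rw [← hQ1 _ _ hx, ← h1]
  exact hQ _ _

/-- The common refinement of a grading with a family of subspaces that is multiplicative and
splits each homogeneous component. -/
theorem IsAlgebraGrading.inf {H : Type*} [AddCommGroup H] (h : IsAlgebraGrading 𝒜)
    {C : H → Submodule F A} (hi : iSupIndep C)
    (hmul : ∀ ⦃k l : H⦄ ⦃x y : A⦄, x ∈ C k → y ∈ C l → x * y ∈ C (k + l))
    (hsplit : ∀ g, 𝒜 g ≤ ⨆ k, C k ⊓ 𝒜 g) :
    IsAlgebraGrading (fun k : H × G => C k.1 ⊓ 𝒜 k.2) where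
  independent := by
    have ht : ⨆ k, C k = ⊤ := by
      rw [eq_top_iff, ← h.iSup_eq_top]
      exact iSup_le fun g => (hsplit g).trans (iSup_mono fun k => inf_le_left)
    obtain ⟨P, -, hP1, hP2, -⟩ := exists_projections h.independent h.iSup_eq_top
    obtain ⟨Q, -, hQ1, hQ2, -⟩ := exists_projections hi ht
    refine iSupIndep_of_separating fun k => ⟨Q k.1 ∘ₗ P k.2, fun x hx h0 => ?_, fun j hj x hx => ?_⟩
    · rwa [LinearMap.comp_apply, hP1 _ _ hx.2, hQ1 _ _ hx.1] at h0
    · rw [LinearMap.comp_apply]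
      by_cases h2 : k.2 = j.2
      · rw [h2, hP1 _ _ hx.2]
        exact hQ2 _ _ _ hx.1 fun h1 => hj (Prod.ext h1 h2).symm
      · rw [hP2 _ _ _ hx.2 h2, map_zero]
  iSup_eq_top := by
    rw [eq_top_iff, ← h.iSup_eq_top]
    exact iSup_le fun g => (hsplit g).trans
      (iSup_le fun k => le_iSup (fun k : H × G => C k.1 ⊓ 𝒜 k.2) (k, g))
  mul_mem := fun _ _ _ _ hx hy => ⟨hmul hx.1 hy.1, h.mul_mem hx.2 hy.2⟩

/-- A grading can be transported along an injective homomorphism of grading groups. -/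
theorem IsAlgebraGrading.pushforward {K : Type*} [AddCommGroup K] (h : IsAlgebraGrading 𝒜)
    (f : G →+ K) (hf : Function.Injective f) :
    IsAlgebraGrading (fun k : K => ⨆ (g : G) (_ : f g = k), 𝒜 g) where
  independent := by
    obtain ⟨P, -, hP1, hP2, -⟩ := exists_projections h.independent h.iSup_eq_top
    refine iSupIndep_of_separating (N := A) fun k => ?_
    by_cases hk : ∃ g, f g = k
    · obtain ⟨g, rfl⟩ := hk
      refine ⟨P g, fun x hx h0 => ?_, fun j hj => ?_⟩
      · have h1 : ⨆ (g' : G) (_ : f g' = f g), 𝒜 g' ≤ 𝒜 g :=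
          iSup₂_le fun g' hg' => by rw [hf hg']
        rw [← hP1 _ _ (h1 hx), h0]
      · have h1 : ⨆ (g' : G) (_ : f g' = j), 𝒜 g' ≤ LinearMap.ker (P g) :=
          iSup₂_le fun g' hg' x hx =>
            hP2 _ _ _ hx fun e => hj (by rw [← hg', e])
        exact fun x hx => h1 hx
    · refine ⟨0, fun x hx _ => ?_, fun _ _ _ _ => rfl⟩
      have h1 : ⨆ (g : G) (_ : f g = k), 𝒜 g ≤ ⊥ := iSup₂_le fun g hg => absurd ⟨g, hg⟩ hk
      exact h1 hx
  iSup_eq_top := by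
    rw [eq_top_iff, ← h.iSup_eq_top]
    exact iSup_le fun g => le_iSup_of_le (f g) (le_iSup₂_of_le g rfl le_rfl)
  mul_mem := by
    intro k l x y hx hy
    have key : ∀ g, f g = k → ∀ x ∈ 𝒜 g,
        ⨆ (g' : G) (_ : f g' = l), 𝒜 g' ≤
          (⨆ (g' : G) (_ : f g' = k + l), 𝒜 g').comap (LinearMap.mulLeft F x) :=
      fun g hg x hx => iSup₂_le fun g' hg' y hy =>
        (le_iSup₂_of_le (f := fun (g : G) (_ : f g = k + l) => 𝒜 g) (g + g')
          (by rw [map_add, hg, hg']) le_rfl) (h.mul_mem hx hy)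
    have key2 : ⨆ (g' : G) (_ : f g' = k), 𝒜 g' ≤
          (⨆ (g' : G) (_ : f g' = k + l), 𝒜 g').comap (LinearMap.mulRight F y) :=
      iSup₂_le fun g hg x hx => key g hg x hx hy
    exact key2 hx

end AlgebraGrading

/-! ### Graded-division algebras over the real numbers -/

section GradedDivisionBasics

variable {F D G : Type*} [Field F] [Ring D] [Algebra F D] [AddCommGroup G] {𝒟 : G → Submodule F D}

theorem IsGradedDivision.exists_inv (h : IsGradedDivision 𝒟) {g : G} {x : D} (hx : x ∈ 𝒟 g)
    (h0 : x ≠ 0) : ∃ y ∈ 𝒟 (-g), x * y = 1 ∧ y * x = 1 := by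
  obtain ⟨u, rfl⟩ := h.isUnit g x hx h0
  exact ⟨↑u⁻¹, h.isGrading.inv_mem hx u.mul_inv u.inv_mul, u.mul_inv, u.inv_mul⟩

theorem IsGradedDivision.mul_eq_zero (h : IsGradedDivision 𝒟) {g : G} {x y : D} (hx : x ∈ 𝒟 g)
    (h0 : x ≠ 0) : x * y = 0 ↔ y = 0 :=
  (h.isUnit g x hx h0).mul_right_eq_zero

theorem IsGradedDivision.mul_ne_zero (h : IsGradedDivision 𝒟) {g : G} {x y : D} (hx : x ∈ 𝒟 g)
    (h0 : x ≠ 0) (hy : y ≠ 0) : x * y ≠ 0 :=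
  fun e => hy ((h.mul_eq_zero hx h0).1 e)

/-- The identity component as a subalgebra. -/
def IsAlgebraGrading.zeroSubalgebra (h : IsAlgebraGrading 𝒟) : Subalgebra F D where
  carrier := 𝒟 0
  mul_mem' := fun ha hb => by simpa using h.mul_mem ha hb
  add_mem' := fun ha hb => (𝒟 0).add_mem ha hb
  algebraMap_mem' := h.algebraMap_mem

theorem IsGradedDivision.zeroSubalgebra_isDomain (h : IsGradedDivision 𝒟) :
    IsDomain h.isGrading.zeroSubalgebra := by
  have := h.nontrivial
  have : NoZeroDivisors h.isGrading.zeroSubalgebra := ⟨fun {a b} hab => by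
    by_cases ha : a = 0
    · exact Or.inl ha
    · right
      have : (a : D) * b = 0 := by simpa using congrArg Subtype.val hab
      exact Subtype.ext ((h.mul_eq_zero a.2 (fun e => ha (Subtype.ext e))).1 this)⟩
  exact NoZeroDivisors.to_isDomain _

end GradedDivisionBasics

section Real

variable {D G : Type*} [Ring D] [Algebra ℝ D] [AddCommGroup G] {𝒟 : G → Submodule ℝ D}

/-- An element of the identity component is real, or the sum of a real number and a nonzero real
multiple of a square root of `-1`: the identity component is a division algebra, and irreducible
real polynomials have degree at most two. -/
theorem IsGradedDivision.real_or_imaginary [FiniteDimensional ℝ D] (h : IsGradedDivision 𝒟) {x : D}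
    (hx : x ∈ 𝒟 0) : (∃ r : ℝ, x = algebraMap ℝ D r) ∨
      ∃ (a b : ℝ) (J : D), b ≠ 0 ∧ J ∈ 𝒟 0 ∧ J * J = -1 ∧ x = algebraMap ℝ D a + b • J := by
  have := h.zeroSubalgebra_isDomain
  set S := h.isGrading.zeroSubalgebra
  let y : S := ⟨x, hx⟩
  have hint : IsIntegral ℝ y := Algebra.IsIntegral.isIntegral y
  have hirr := minpoly.irreducible hint
  have hdeg := hirr.degree_le_two
  have hmon := minpoly.monic hint
  have hroot := minpoly.aeval ℝ y
  generalize minpoly ℝ y = m at hdeg hmon hroot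
  rw [Polynomial.eq_quadratic_of_degree_le_two hdeg] at hmon hroot
  generalize m.coeff 2 = a at hmon hroot
  generalize m.coeff 1 = b at hmon hroot
  generalize m.coeff 0 = c at hmon hroot
  have hroot' : a • (x * x) + b • x + algebraMap ℝ D c = 0 := by
    have := congrArg (Subtype.val) hroot
    simpa [y, pow_two, Algebra.smul_def] using this
  by_cases ha : a = 0
  · subst ha
    have hb : b ≠ 0 := by
      rintro rfl
      have h1 : algebraMap ℝ D c = 0 := by simpa using hroot'
      have hc : c = 0 := by
        have := h.nontrivial
        exact (map_eq_zero (algebraMap ℝ D)).1 h1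
      subst hc
      simp at hmon
    left
    refine ⟨-(b⁻¹ * c), ?_⟩
    have h1 : b • x = - algebraMap ℝ D c := by
      rw [zero_smul, zero_add] at hroot'
      exact eq_neg_of_add_eq_zero_left hroot'
    calc x = b⁻¹ • (b • x) := by rw [smul_smul, inv_mul_cancel₀ hb, one_smul]
      _ = _ := by rw [h1]; simp [Algebra.smul_def]
  · -- complete the square
    set p : ℝ := b / (2 * a)
    set Δ : ℝ := p ^ 2 - c / a
    have hsq : (x + algebraMap ℝ D p) * (x + algebraMap ℝ D p) = algebraMap ℝ D Δ := by
      have h1 : x * x = - ((b / a) • x + algebraMap ℝ D (c / a)) := by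
        have : a⁻¹ • (a • (x * x) + b • x + algebraMap ℝ D c) = 0 := by rw [hroot', smul_zero]
        rw [eq_neg_iff_add_eq_zero, ← this]
        simp only [smul_add, smul_smul, inv_mul_cancel₀ ha, one_smul,
          Algebra.algebraMap_eq_smul_one]
        rw [add_assoc]; congr 3 <;> field_simp
      have h2 : (x + algebraMap ℝ D p) * (x + algebraMap ℝ D p)
          = x * x + (2 * p) • x + algebraMap ℝ D (p ^ 2) := by
        rw [mul_add, add_mul, add_mul, ← Algebra.commutes p x, ← Algebra.smul_def, pow_two, map_mul]
        module
      rw [h2, h1]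
      have h3 : 2 * p = b / a := by simp only [p]; field_simp
      rw [h3, map_sub]; abel
    have hxp : x + algebraMap ℝ D p ∈ 𝒟 0 := (𝒟 0).add_mem hx (h.isGrading.algebraMap_mem p)
    rcases le_or_gt 0 Δ with hΔ | hΔ
    · left
      set r := Real.sqrt Δ
      have hr : r * r = Δ := Real.mul_self_sqrt hΔ
      have h3 : (x + algebraMap ℝ D p - algebraMap ℝ D r) *
          (x + algebraMap ℝ D p + algebraMap ℝ D r) = 0 := by
        rw [← hr, map_mul] at hsq
        rw [(Algebra.commute_algebraMap_right r _).mul_self_sub_mul_self_eq'.symm, hsq, sub_self]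
      by_cases h4 : x + algebraMap ℝ D p - algebraMap ℝ D r = 0
      · exact ⟨r - p, by rw [map_sub, eq_sub_iff_add_eq]; exact sub_eq_zero.1 h4⟩
      · have h5 := (h.mul_eq_zero ((𝒟 0).sub_mem hxp (h.isGrading.algebraMap_mem r)) h4).1 h3
        refine ⟨-r - p, ?_⟩
        rw [map_sub, map_neg, eq_sub_iff_add_eq]
        exact eq_neg_of_add_eq_zero_left h5
    · right
      set r := Real.sqrt (-Δ)
      have hr : r * r = -Δ := Real.mul_self_sqrt (by linarith)
      have hr0 : r ≠ 0 := by rintro h0; rw [h0] at hr; linarith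
      refine ⟨-p, r, r⁻¹ • (x + algebraMap ℝ D p), hr0, (𝒟 0).smul_mem _ hxp, ?_, ?_⟩
      · rw [smul_mul_smul_comm, hsq, Algebra.algebraMap_eq_smul_one, smul_smul]
        have : r⁻¹ * r⁻¹ * Δ = -1 := by
          have : Δ = - (r * r) := by linarith
          rw [this]; field_simp
        rw [this, neg_smul, one_smul]
      · rw [smul_smul, mul_inv_cancel₀ hr0, one_smul, map_neg]; abel

end Real

/-! ### Adapted refinements -/

section Adapted

variable {D G : Type*} [Ring D] [Algebra ℝ D] [AddCommGroup G] {𝒟 : G → Submodule ℝ D}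

/-- A grading `C` of `D` by `H × G` that properly refines the grading `𝒟` by `G` and is adapted to
the involution `σ`: its components are invariant, and each symmetric or skew element of `𝒟 g`
becomes homogeneous after a change `p ↦ σ d * p * d` with `d` in the identity component. Such an
element `p` will be a diagonal entry of a hermitian matrix, and the change corresponds to
rescaling the basis vector. -/
structure IsAdaptedRefinement {H : Type*} [AddCommGroup H] (𝒟 : G → Submodule ℝ D)
    (σ : D →ₗ[ℝ] D) (C : H × G → Submodule ℝ D) : Prop where
  isGrading : IsAlgebraGrading C
  le : ∀ k, C k ≤ 𝒟 k.2
  proper : ∃ x ∈ 𝒟 0, x ∉ C 0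
  invariant : PreservesDegree C σ
  adapted : ∀ g, ∀ p ∈ 𝒟 g, p ≠ 0 → (σ p = p ∨ σ p = -p) →
    ∃ d ∈ 𝒟 0, d ≠ 0 ∧ ∃ k, σ d * p * d ∈ C k

theorem IsInvolution.map_one {A : Type*} [Ring A] [Algebra ℝ A] {σ : A →ₗ[ℝ] A}
    (h : IsInvolution σ) : σ 1 = 1 := by
  have h1 := h.map_mul (σ 1) 1
  rw [mul_one, h.involutive, mul_one] at h1
  exact h1.symm

theorem IsInvolution.map_algebraMap {A : Type*} [Ring A] [Algebra ℝ A] {σ : A →ₗ[ℝ] A}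
    (h : IsInvolution σ) (r : ℝ) : σ (algebraMap ℝ A r) = algebraMap ℝ A r := by
  rw [Algebra.algebraMap_eq_smul_one, map_smul, h.map_one]

theorem not_real_of_sq_eq_neg_one [Nontrivial D] {J : D} (hJ : J * J = -1) (r : ℝ) :
    J ≠ algebraMap ℝ D r := by
  rintro rfl
  rw [← map_mul, ← map_one (algebraMap ℝ D), ← map_neg] at hJ
  have := (algebraMap ℝ D).injective hJ
  nlinarith [mul_self_nonneg r]

/-! ### Noncommutative identity component -/

/-- An involution of a noncommutative finite-dimensional real division algebra negates some
square root of `-1`. -/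
theorem IsGradedDivision.exists_skew_imaginary [FiniteDimensional ℝ D] (h : IsGradedDivision 𝒟)
    (hnc : ∃ x ∈ 𝒟 0, ∃ y ∈ 𝒟 0, x * y ≠ y * x)
    (τ : D →ₗ[ℝ] D) (hτ0 : ∀ x ∈ 𝒟 0, τ x ∈ 𝒟 0) (hτ1 : τ 1 = 1)
    (hτm : ∀ x y, τ (x * y) = τ y * τ x) (hττ : ∀ x ∈ 𝒟 0, τ (τ x) = x) :
    ∃ J ∈ 𝒟 0, J * J = -1 ∧ τ J = -J := by
  have := h.nontrivial
  obtain ⟨x, hx, hτx⟩ : ∃ x ∈ 𝒟 0, τ x ≠ x := by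
    by_contra! hall
    obtain ⟨x, hx, y, hy, hxy⟩ := hnc
    refine hxy ?_
    have := hτm x y
    have h2 := h.isGrading.mul_mem hx hy
    rw [add_zero] at h2
    rwa [hall _ hx, hall _ hy, hall _ h2] at this
  have hy : τ (x - τ x) = -(x - τ x) := by rw [map_sub, hττ x hx]; abel
  have hy0 : x - τ x ≠ 0 := fun e => hτx (sub_eq_zero.1 e).symm
  have hτr : ∀ r : ℝ, τ (algebraMap ℝ D r) = algebraMap ℝ D r := fun r => by
    rw [Algebra.algebraMap_eq_smul_one, map_smul, hτ1]
  generalize hyx : x - τ x = y at hy hy0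
  have hyD : y ∈ 𝒟 0 := hyx ▸ (𝒟 0).sub_mem hx (hτ0 x hx)
  rcases h.real_or_imaginary hyD with ⟨r, rfl⟩ | ⟨a, b, J, hb, hJD, hJ, rfl⟩
  · rw [hτr] at hy
    have h2 : (2 : ℝ) • algebraMap ℝ D r = 0 := by
      rw [two_smul]; exact add_eq_zero_iff_eq_neg.2 hy
    exact absurd ((smul_eq_zero.1 h2).resolve_left two_ne_zero) hy0
  · refine ⟨J, hJD, hJ, ?_⟩
    -- applying `τ` to `J² = -1` shows that the real part `a` vanishes
    set s : ℝ := b⁻¹ * (2 * a)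
    have h1 : τ J = -(J + algebraMap ℝ D s) := by
      have h2 : b • τ J = -(b • J + algebraMap ℝ D (2 * a)) := by
        rw [map_add, hτr, map_smul] at hy
        rw [eq_sub_of_add_eq' hy, two_mul, map_add]; abel
      calc τ J = b⁻¹ • (b • τ J) := by rw [smul_smul, inv_mul_cancel₀ hb, one_smul]
        _ = _ := by
          rw [h2, smul_neg, smul_add, smul_smul, inv_mul_cancel₀ hb, one_smul,
            Algebra.smul_def b⁻¹ (algebraMap ℝ D _), ← map_mul]
    have h3 : τ J * τ J = -1 := by rw [← hτm, hJ, map_neg, hτ1]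
    rw [h1, neg_mul_neg, add_mul, mul_add, mul_add, hJ, ← Algebra.commutes s J] at h3
    have h4 : algebraMap ℝ D s * (J + J + algebraMap ℝ D s) = 0 := by
      rw [mul_add, mul_add]
      rw [add_assoc] at h3
      have h5 := add_eq_left.1 h3
      rw [← h5]; abel
    have hs : s = 0 := by
      by_contra hs
      have hs' : algebraMap ℝ D s ≠ 0 := by simpa using hs
      have h5 := (h.mul_eq_zero (h.isGrading.algebraMap_mem s) hs').1 h4
      refine not_real_of_sq_eq_neg_one hJ (-s / 2) ?_
      have h6 : (2 : ℝ) • J = - algebraMap ℝ D s := by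
        rw [two_smul]; exact eq_neg_of_add_eq_zero_left h5
      calc J = (2⁻¹ : ℝ) • ((2 : ℝ) • J) := by rw [smul_smul]; norm_num
        _ = _ := by
          rw [h6, ← map_neg, Algebra.smul_def, ← map_mul]; congr 1; ring
    rw [h1, hs, map_zero, add_zero]

theorem IsGradedDivision.eq_or_eq_neg_of_commute (h : IsGradedDivision 𝒟) {J J' : D}
    (hJD : J ∈ 𝒟 0) (hJ'D : J' ∈ 𝒟 0) (hJ : J * J = -1) (hJ' : J' * J' = -1)
    (hc : J * J' = J' * J) : J' = J ∨ J' = -J := by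
  by_cases h0 : J' - J = 0
  · exact Or.inl (sub_eq_zero.1 h0)
  · right
    have h1 : (J' - J) * (J' + J) = 0 := by
      rw [sub_mul, mul_add, mul_add, hJ, hJ', hc]; abel
    exact eq_neg_of_add_eq_zero_left ((h.mul_eq_zero ((𝒟 0).sub_mem hJ'D hJD) h0).1 h1)

/-- If `J` is central in the identity component, the latter is `ℝ ⊕ ℝ J`. -/
theorem IsGradedDivision.exists_eq_add_smul [FiniteDimensional ℝ D] (h : IsGradedDivision 𝒟) {J : D}
    (hJD : J ∈ 𝒟 0) (hJ : J * J = -1) (hc : ∀ x ∈ 𝒟 0, J * x = x * J) {x : D} (hx : x ∈ 𝒟 0) :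
    ∃ a b : ℝ, x = algebraMap ℝ D a + b • J := by
  rcases h.real_or_imaginary hx with ⟨r, rfl⟩ | ⟨a, b, J', hb, hJD', hJ', rfl⟩
  · exact ⟨r, 0, by simp⟩
  · rcases h.eq_or_eq_neg_of_commute hJD hJD' hJ hJ' (hc _ hJD') with rfl | rfl
    · exact ⟨a, b, rfl⟩
    · exact ⟨a, -b, by simp⟩

/-- In a noncommutative identity component all square roots of `-1` are conjugate. -/
theorem IsGradedDivision.exists_conj [FiniteDimensional ℝ D] (h : IsGradedDivision 𝒟)
    (hnc : ∃ x ∈ 𝒟 0, ∃ y ∈ 𝒟 0, x * y ≠ y * x) {J J' : D}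
    (hJD : J ∈ 𝒟 0) (hJ'D : J' ∈ 𝒟 0) (hJ : J * J = -1) (hJ' : J' * J' = -1) :
    ∃ d ∈ 𝒟 0, d ≠ 0 ∧ J' * d = d * J := by
  by_cases h0 : J + J' = 0
  · obtain rfl : J' = -J := eq_neg_of_add_eq_zero_right h0
    obtain ⟨y, hy, hyJ⟩ : ∃ y ∈ 𝒟 0, J * y ≠ y * J := by
      by_contra! hall
      obtain ⟨x, hx, y, hy, hxy⟩ := hnc
      obtain ⟨a, b, rfl⟩ := h.exists_eq_add_smul hJD hJ hall hx
      refine hxy ?_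
      rw [add_mul, mul_add, Algebra.commutes, smul_mul_assoc, mul_smul_comm, hall _ hy]
    have hJJ : ∀ z, J * (J * z) = -z := fun z => by rw [← mul_assoc, hJ, neg_one_mul]
    refine ⟨y + J * y * J, (𝒟 0).add_mem hy ?_, fun h1 => hyJ ?_, ?_⟩
    · simpa using h.isGrading.mul_mem (h.isGrading.mul_mem hJD hy) hJD
    · have h2 : J * (y + J * y * J) = 0 := by rw [h1, mul_zero]
      rw [mul_add, mul_assoc J y J, hJJ, ← sub_eq_add_neg] at h2
      exact sub_eq_zero.1 h2
    · rw [mul_add, add_mul, mul_assoc (J * y) J J, hJ, neg_mul, neg_mul, mul_assoc J y J, hJJ]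
      simp [add_comm]
  · refine ⟨J + J', (𝒟 0).add_mem hJD hJ'D, h0, ?_⟩
    rw [mul_add, add_mul, hJ, hJ', add_comm]

/-- If the identity component is noncommutative, conjugation by a skew square root of `-1` in it
gives an adapted refinement. -/
theorem IsGradedDivision.exists_adapted_of_noncomm [FiniteDimensional ℝ D] (h : IsGradedDivision 𝒟)
    (hnc : ∃ x ∈ 𝒟 0, ∃ y ∈ 𝒟 0, x * y ≠ y * x)
    {σ : D →ₗ[ℝ] D} (hσ : IsInvolution σ) (hσd : PreservesDegree 𝒟 σ) :
    ∃ C : ZMod 2 × G → Submodule ℝ D, IsAdaptedRefinement 𝒟 σ C := by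
  have := h.nontrivial
  obtain ⟨J, hJD, hJ, hσJ⟩ := h.exists_skew_imaginary hnc σ (hσd 0) hσ.map_one hσ.map_mul
    (fun x _ => hσ.involutive x)
  have hJJ : ∀ z, J * (J * z) = -z := fun z => by rw [← mul_assoc, hJ, neg_one_mul]
  have hJJ' : ∀ z, z * J * J = -z := fun z => by rw [mul_assoc, hJ, mul_neg_one]
  -- the sign with which conjugation by `J` acts
  let s : ZMod 2 → ℝ := fun k => if k = 0 then 1 else -1
  have hs0 : s 0 = 1 := if_pos rfl
  have hs1 : s 1 = -1 := if_neg (by decide)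
  have hk : ∀ k : ZMod 2, k = 0 ∨ k = 1 := by decide
  have hs : ∀ k l, s (k + l) = s k * s l := by
    intro k l
    rcases hk k with rfl | rfl
    · rw [zero_add, hs0, one_mul]
    · rcases hk l with rfl | rfl
      · rw [add_zero, hs0, mul_one]
      · rw [show (1 + 1 : ZMod 2) = 0 by decide, hs0, hs1]; norm_num
  have hss : ∀ k, s k * s k = 1 := by
    intro k; rcases hk k with rfl | rfl <;> simp [hs0, hs1]
  let C : ZMod 2 → Submodule ℝ D := fun k =>
    LinearMap.ker (LinearMap.mulLeft ℝ J - s k • LinearMap.mulRight ℝ J)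
  have hC : ∀ k x, x ∈ C k ↔ J * x = s k • (x * J) := fun k x => by
    simp only [C, LinearMap.mem_ker, LinearMap.sub_apply, LinearMap.smul_apply,
      LinearMap.mulLeft_apply, LinearMap.mulRight_apply, sub_eq_zero]
  have hmem0 : ∀ g, ∀ x ∈ 𝒟 g, J * x * J ∈ 𝒟 g := fun g x hx => by
    simpa using h.isGrading.mul_mem (h.isGrading.mul_mem hJD hx) hJD
  have hgr : IsAlgebraGrading (fun k : ZMod 2 × G => C k.1 ⊓ 𝒟 k.2) := by
    refine h.isGrading.inf ?_ ?_ ?_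
    · refine iSupIndep_of_separating fun k =>
        ⟨LinearMap.mulLeft ℝ J + s k • LinearMap.mulRight ℝ J, fun x hx h0 => ?_,
          fun j hj x hx => ?_⟩
      · rw [LinearMap.add_apply, LinearMap.smul_apply, LinearMap.mulLeft_apply,
          LinearMap.mulRight_apply, ← (hC k x).1 hx, ← two_smul ℝ] at h0
        exact (h.mul_eq_zero hJD (by rintro rfl; simp at hJ)).1
          ((smul_eq_zero.1 h0).resolve_left two_ne_zero)
      · rw [LinearMap.add_apply, LinearMap.smul_apply, LinearMap.mulLeft_apply,
          LinearMap.mulRight_apply, (hC j x).1 hx, ← add_smul]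
        have : s j + s k = 0 := by
          rcases hk j with rfl | rfl <;> rcases hk k with rfl | rfl <;> simp [hs0, hs1] at hj ⊢
        rw [this, zero_smul]
    · intro k l x y hx hy
      rw [hC] at hx hy ⊢
      rw [← mul_assoc, hx, smul_mul_assoc, mul_assoc, hy, mul_smul_comm, smul_smul, ← mul_assoc, hs]
    · intro g x hx
      have h1 : x = (2⁻¹ : ℝ) • (x - J * x * J) + (2⁻¹ : ℝ) • (x + J * x * J) := by
        rw [← smul_add, sub_add_add_cancel, ← two_smul ℝ x, smul_smul]; norm_num
      rw [h1]
      refine Submodule.add_mem _ (Submodule.mem_iSup_of_mem 0 (Submodule.smul_mem _ _ ⟨?_, ?_⟩))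
        (Submodule.mem_iSup_of_mem 1 (Submodule.smul_mem _ _ ⟨?_, ?_⟩))
      · rw [SetLike.mem_coe, hC, hs0, one_smul, mul_sub, sub_mul, mul_assoc J x J, hJJ,
          ← mul_assoc J x J, hJJ']
        abel
      · exact (𝒟 g).sub_mem hx (hmem0 g x hx)
      · rw [SetLike.mem_coe, hC]
        rw [hs1, neg_one_smul, mul_add, add_mul, mul_assoc J x J, hJJ, ← mul_assoc J x J, hJJ']
        abel
      · exact (𝒟 g).add_mem hx (hmem0 g x hx)
  refine ⟨_, hgr, fun k => inf_le_right, ?_, ?_, ?_⟩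
  · by_contra! hall
    obtain ⟨x, hx, y, hy, hxy⟩ := hnc
    have hcen : ∀ x ∈ 𝒟 0, J * x = x * J := fun x hx => by
      have := (hC 0 x).1 (hall x hx).1
      simpa [hs0] using this
    obtain ⟨a, b, rfl⟩ := h.exists_eq_add_smul hJD hJ hcen hx
    refine hxy ?_
    rw [add_mul, mul_add, Algebra.commutes, smul_mul_assoc, mul_smul_comm, hcen _ hy]
  · rintro ⟨k, g⟩ x ⟨hx1, hx2⟩
    refine ⟨?_, hσd g x hx2⟩
    have h1 := congrArg σ ((hC k x).1 hx1)
    rw [map_smul, hσ.map_mul, hσ.map_mul, hσJ, mul_neg, neg_mul, smul_neg, neg_inj] at h1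
    change σ x ∈ C k
    rw [hC, h1, smul_smul, hss, one_smul]
  · intro g p hp hp0 hps
    obtain ⟨q, hq, hpq, hqp⟩ := h.exists_inv hp hp0
    -- the involution of the identity component obtained by twisting `σ` with `p`
    let τ : D →ₗ[ℝ] D := LinearMap.mulLeft ℝ q ∘ₗ LinearMap.mulRight ℝ p ∘ₗ σ
    have hτ : ∀ x, τ x = q * (σ x * p) := fun x => rfl
    have hστ : ∀ x, σ x * p = p * τ x := fun x => by
      rw [hτ, ← mul_assoc p q, hpq, one_mul]
    obtain ⟨J', hJ'D, hJ', hτJ'⟩ := h.exists_skew_imaginary hnc τ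
      (fun x hx => by
        have := h.isGrading.mul_mem hq (h.isGrading.mul_mem (hσd 0 x hx) hp)
        rwa [zero_add, neg_add_cancel] at this)
      (by rw [hτ, hσ.map_one, one_mul, hqp])
      (fun x y => by
        rw [hτ, hσ.map_mul, mul_assoc (σ y), hστ x, hτ y]; simp only [mul_assoc])
      (fun x _ => by
        have h1 : σ (σ x * p) = σ (p * τ x) := by rw [hστ]
        rw [hσ.map_mul, hσ.map_mul, hσ.involutive] at h1
        have h2 : p * x = σ (τ x) * p := by
          rcases hps with e | e
          · rwa [e] at h1
          · rwa [e, neg_mul, mul_neg, neg_inj] at h1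
        rw [hτ, ← h2, ← mul_assoc, hqp, one_mul])
    obtain ⟨d, hd, hd0, hdJ⟩ := h.exists_conj hnc hJD hJ'D hJ hJ'
    refine ⟨d, hd, hd0, (0, g), ?_, ?_⟩
    · change _ ∈ C 0
      rw [hC, hs0, one_smul]
      have h1 : σ d * σ J' = -(J * σ d) := by
        have := congrArg σ hdJ
        rwa [hσ.map_mul, hσ.map_mul, hσJ, neg_mul] at this
      have h2 : σ J' * p = -(p * J') := by rw [hστ, hτJ', mul_neg]
      calc J * (σ d * p * d) = (J * σ d) * p * d := by simp only [mul_assoc]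
        _ = -(σ d * (σ J' * p) * d) := by
          rw [← neg_neg (J * σ d), ← h1]; simp only [mul_assoc, neg_mul]
        _ = σ d * p * (J' * d) := by rw [h2]; simp only [mul_assoc, neg_mul, mul_neg, neg_neg]
        _ = σ d * p * d * J := by rw [hdJ]; simp only [mul_assoc]
    · simpa using h.isGrading.mul_mem (h.isGrading.mul_mem (hσd 0 d hd) hp) hd

end Adapted

/-! ### Refinements of a division grading -/

section Refinements

variable {D G H : Type*} [Ring D] [Algebra ℝ D] [AddCommGroup G] [AddCommGroup H]
  {𝒟 : G → Submodule ℝ D} {ℬ : H → Submodule ℝ D}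

/-- A refinement of a grading is its own common refinement with that grading. -/
theorem IsAlgebraGrading.inf_of_isRefinement (h : IsAlgebraGrading 𝒟) (hB : IsAlgebraGrading ℬ)
    (hr : IsRefinement ℬ 𝒟) : IsAlgebraGrading (fun k : H × G => ℬ k.1 ⊓ 𝒟 k.2) := by
  refine h.inf hB.independent hB.mul_mem fun g x hx => ?_
  obtain ⟨P, hP, -, -, hs, hPg⟩ :=
    hr.exists_projections hB.independent hB.iSup_eq_top h.independent
  obtain ⟨s, hx'⟩ := hs x
  rw [hx']
  exact Submodule.sum_mem _ fun i _ => Submodule.mem_iSup_of_mem i ⟨hP i x, hPg g i x hx⟩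

theorem IsRefinement.zero_le [Nontrivial D] (h : IsAlgebraGrading 𝒟) (hB : IsAlgebraGrading ℬ)
    (hr : IsRefinement ℬ 𝒟) : ℬ 0 ≤ 𝒟 0 := by
  obtain ⟨g, hg⟩ := hr 0
  by_cases h0 : g = 0
  · rwa [h0] at hg
  · exact absurd (eq_zero_of_iSupIndep h.independent h0 (hg hB.one_mem) h.one_mem) one_ne_zero

/-- A proper refinement of a division grading properly refines the identity component. -/
theorem IsProperRefinement.exists_not_mem_zero (h : IsGradedDivision 𝒟)
    (hB : IsAlgebraGrading ℬ) (hr : IsProperRefinement ℬ 𝒟) : ∃ x ∈ 𝒟 0, x ∉ ℬ 0 := by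
  by_contra! hall
  obtain ⟨-, k, g, hk, hlt⟩ := hr
  obtain ⟨x, hx, hx0⟩ := (Submodule.ne_bot_iff _).1 hk
  obtain ⟨y, hy, hxy, hyx⟩ := h.exists_inv (hlt.le hx) hx0
  refine hlt.not_ge fun z hz => ?_
  have h1 := h.isGrading.mul_mem hz hy
  rw [add_neg_cancel] at h1
  have h2 := hB.mul_mem (hall _ h1) hx
  rwa [zero_add, mul_assoc, hyx, mul_one] at h2

/-- Two nonzero elements of a component are proportional if the identity component of the
grading is `ℝ`. -/
theorem IsRefinement.exists_eq_smul (h : IsGradedDivision 𝒟) (hB : IsAlgebraGrading ℬ)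
    (hr : IsRefinement ℬ 𝒟) (hR : ∀ x ∈ ℬ 0, ∃ r : ℝ, x = algebraMap ℝ D r) {k : H} {x y : D}
    (hx : x ∈ ℬ k) (hx0 : x ≠ 0) (hy : y ∈ ℬ k) : ∃ r : ℝ, y = r • x := by
  obtain ⟨g, hg⟩ := hr k
  obtain ⟨u, hu, hxu, hux⟩ := h.exists_inv (hg hx) hx0
  have h1 := hB.mul_mem hy (hB.inv_mem hx hxu hux)
  rw [add_neg_cancel] at h1
  obtain ⟨r, hr⟩ := hR _ h1
  refine ⟨r, ?_⟩
  rw [Algebra.smul_def, ← hr, mul_assoc, hux, mul_one]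

/-- If the identity component is commutative and refines properly, the identity component of the
refinement is `ℝ`. -/
theorem IsRefinement.zero_real (h : IsGradedDivision 𝒟) [FiniteDimensional ℝ D]
    (hB : IsAlgebraGrading ℬ) (hr : IsRefinement ℬ 𝒟) (hne : ∃ x ∈ 𝒟 0, x ∉ ℬ 0) {J : D}
    (hJD : J ∈ 𝒟 0) (hJ : J * J = -1) (hc : ∀ x ∈ 𝒟 0, J * x = x * J) :
    ∀ x ∈ ℬ 0, ∃ r : ℝ, x = algebraMap ℝ D r := by
  have := h.nontrivial
  intro x hx
  obtain ⟨a, b, rfl⟩ := h.exists_eq_add_smul hJD hJ hc (hr.zero_le h.isGrading hB hx)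
  by_cases hb : b = 0
  · exact ⟨a, by rw [hb, zero_smul, add_zero]⟩
  exfalso
  have hJB : J ∈ ℬ 0 := by
    have h1 := (ℬ 0).smul_mem b⁻¹ ((ℬ 0).sub_mem hx (hB.algebraMap_mem a))
    rwa [add_sub_cancel_left, smul_smul, inv_mul_cancel₀ hb, one_smul] at h1
  obtain ⟨y, hy, hyB⟩ := hne
  obtain ⟨a', b', rfl⟩ := h.exists_eq_add_smul hJD hJ hc hy
  exact hyB ((ℬ 0).add_mem (hB.algebraMap_mem _) ((ℬ 0).smul_mem _ hJB))

/-- A square root of `-1` in the identity component is homogeneous in the refinement: it has a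
component `a + b J` of nonzero degree `k`, and the shape of the square of this component shows that
`k + k = 0` and `a = 0`. -/
theorem IsRefinement.exists_imaginary_mem (h : IsGradedDivision 𝒟) [FiniteDimensional ℝ D]
    (hB : IsAlgebraGrading ℬ) (hr : IsRefinement ℬ 𝒟)
    (hR : ∀ x ∈ ℬ 0, ∃ r : ℝ, x = algebraMap ℝ D r) {J : D}
    (hJD : J ∈ 𝒟 0) (hJ : J * J = -1) (hc : ∀ x ∈ 𝒟 0, J * x = x * J) :
    ∃ k, J ∈ ℬ k := by
  have := h.nontrivial
  obtain ⟨P, hP, hP1, hP2, hs, hPg⟩ :=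
    hr.exists_projections hB.independent hB.iSup_eq_top h.isGrading.independent
  obtain ⟨k, hk0, hPk⟩ : ∃ k, k ≠ 0 ∧ P k J ≠ 0 := by
    by_contra! hall
    obtain ⟨s, hJs⟩ := hs J
    have h1 : J ∈ ℬ 0 := by
      rw [hJs]
      refine Submodule.sum_mem _ fun i _ => ?_
      by_cases hi : i = 0
      · rw [hi]; exact hP 0 J
      · rw [hall i hi]; exact Submodule.zero_mem _
    obtain ⟨r, hr⟩ := hR _ h1
    exact not_real_of_sq_eq_neg_one hJ r hr
  have hxB := hP k J
  have hxD := hPg 0 k J hJD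
  generalize P k J = x at hPk hxB hxD
  obtain ⟨a, b, rfl⟩ := h.exists_eq_add_smul hJD hJ hc hxD
  have hb : b ≠ 0 := by
    rintro rfl
    rw [zero_smul, add_zero] at hxB hPk
    exact hPk (eq_zero_of_iSupIndep hB.independent hk0 hxB (hB.algebraMap_mem a))
  -- the square of `a + b J` is `2 a (a + b J) - (a ^ 2 + b ^ 2)`
  have h2 : (algebraMap ℝ D a + b • J) * (algebraMap ℝ D a + b • J) =
      (2 * a) • (algebraMap ℝ D a + b • J) - algebraMap ℝ D (a ^ 2 + b ^ 2) := by
    simp only [Algebra.algebraMap_eq_smul_one, add_mul, mul_add, smul_mul_smul_comm, hJ, one_mul,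
      mul_one]
    module
  have h3 := hB.mul_mem hxB hxB
  rw [h2] at h3
  have hn : algebraMap ℝ D (a ^ 2 + b ^ 2) ≠ 0 := by
    have : a ^ 2 + b ^ 2 ≠ 0 := by positivity
    exact (map_ne_zero (algebraMap ℝ D)).2 this
  have hkk : k + k = 0 := by
    by_contra hkk
    have h4 := hP2 _ 0 _ h3 (Ne.symm hkk)
    rw [map_sub, map_smul, hP2 _ 0 _ hxB (Ne.symm hk0), smul_zero, zero_sub,
      hP1 0 _ (hB.algebraMap_mem _)] at h4
    exact hn (neg_eq_zero.1 h4)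
  rw [hkk] at h3
  have h4 := hP2 _ k _ h3 hk0
  rw [map_sub, map_smul, hP1 _ _ hxB, hP2 _ k _ (hB.algebraMap_mem _) hk0, sub_zero] at h4
  have ha : a = 0 := by simpa using (smul_eq_zero.1 h4).resolve_right hPk
  subst ha
  refine ⟨k, ?_⟩
  have h5 := (ℬ k).smul_mem b⁻¹ hxB
  rwa [map_zero, zero_add, smul_smul, inv_mul_cancel₀ hb, one_smul] at h5

/-- An element of the identity component that commutes with it and squares to `-1` commutes or
anticommutes with each homogeneous element. -/
theorem IsGradedDivision.commute_or_anticommute (h : IsGradedDivision 𝒟) {J : D}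
    (hJD : J ∈ 𝒟 0) (hJ : J * J = -1) (hc : ∀ x ∈ 𝒟 0, J * x = x * J) {g : G} {x : D}
    (hx : x ∈ 𝒟 g) : x * J = J * x ∨ x * J = -(J * x) := by
  by_cases h0 : x = 0
  · left; rw [h0, zero_mul, mul_zero]
  obtain ⟨y, hy, hxy, hyx⟩ := h.exists_inv hx h0
  have h1 : x * J * y ∈ 𝒟 0 := by
    have := h.isGrading.mul_mem (h.isGrading.mul_mem hx hJD) hy
    rwa [add_zero, add_neg_cancel] at this
  have h2 : x * J * y * (x * J * y) = -1 := by
    calc x * J * y * (x * J * y) = x * J * (y * x) * (J * y) := by simp only [mul_assoc]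
      _ = x * (J * J) * y := by rw [hyx, mul_one]; simp only [mul_assoc]
      _ = -1 := by rw [hJ, mul_neg_one, neg_mul, hxy]
  have h3 : x * J = x * J * y * x := by rw [mul_assoc (x * J), hyx, mul_one]
  rcases h.eq_or_eq_neg_of_commute hJD h1 hJ h2 (hc _ h1) with e | e
  · left; rw [h3, e]
  · right; rw [h3, e, neg_mul]

end Refinements

/-! ### Commutative identity component that is not central -/

section NonCentral

variable {D G H : Type*} [Ring D] [Algebra ℝ D] [AddCommGroup G] [AddCommGroup H]
  {𝒟 : G → Submodule ℝ D} {ℬ : H → Submodule ℝ D}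

theorem lift_apply_eq {J : D} (hJ : J * J = -1) (w : ℂ) :
    Complex.lift ⟨J, hJ⟩ w = algebraMap ℝ D w.re + w.im • J :=
  Complex.liftAux_apply J hJ w

/-- An element that commutes or anticommutes with `J` commutes with the copy of `ℂ` generated by
`J` up to the identity or complex conjugation. -/
theorem exists_twist_of_commute_or_anticommute {J : D} (hJ : J * J = -1) {x : D}
    (hx : x * J = J * x ∨ x * J = -(J * x)) :
    ∃ f : ℂ → ℂ, (f = id ∨ f = starRingEnd ℂ) ∧
      ∀ w, x * Complex.lift ⟨J, hJ⟩ w = Complex.lift ⟨J, hJ⟩ (f w) * x := by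
  rcases hx with hx | hx
  · refine ⟨id, Or.inl rfl, fun w => ?_⟩
    simp only [lift_apply_eq, id_eq, mul_add, add_mul, mul_smul_comm, smul_mul_assoc, hx,
      Algebra.commutes]
  · refine ⟨starRingEnd ℂ, Or.inr rfl, fun w => ?_⟩
    simp only [lift_apply_eq, Complex.conj_re, Complex.conj_im, mul_add, add_mul, mul_smul_comm,
      smul_mul_assoc, hx, Algebra.commutes, neg_smul, smul_neg, neg_mul]

theorem twist_twist {f : ℂ → ℂ} (hf : f = id ∨ f = starRingEnd ℂ) (w : ℂ) : f (f w) = w := by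
  rcases hf with rfl | rfl <;> simp

/-- If an involution `σ` restricts to the identity component `ℂ` in the same way as conjugation by
a homogeneous element `x`, then `x` is symmetric or skew. -/
theorem IsGradedDivision.symm_or_skew_of_twist_eq (h : IsGradedDivision 𝒟)
    [FiniteDimensional ℝ D] {J : D}
    (hJD : J ∈ 𝒟 0) (hJ : J * J = -1) (hc : ∀ x ∈ 𝒟 0, J * x = x * J)
    {σ : D →ₗ[ℝ] D} (hσ : IsInvolution σ) (hσd : PreservesDegree 𝒟 σ)
    {f : ℂ → ℂ} (hf : f = id ∨ f = starRingEnd ℂ)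
    (hσf : ∀ w, σ (Complex.lift ⟨J, hJ⟩ w) = Complex.lift ⟨J, hJ⟩ (f w)) {g : G} {x : D}
    (hx : x ∈ 𝒟 g) (hxf : ∀ w, x * Complex.lift ⟨J, hJ⟩ w = Complex.lift ⟨J, hJ⟩ (f w) * x) :
    σ x = x ∨ σ x = -x := by
  have := h.nontrivial
  by_cases h0 : x = 0
  · left; rw [h0, map_zero]
  obtain ⟨y, hy, hxy, hyx⟩ := h.exists_inv hx h0
  obtain ⟨w, hw⟩ : ∃ w, σ x * y = Complex.lift ⟨J, hJ⟩ w := by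
    have h1 := h.isGrading.mul_mem (hσd g x hx) hy
    rw [add_neg_cancel] at h1
    obtain ⟨a, b, e⟩ := h.exists_eq_add_smul hJD hJ hc h1
    exact ⟨⟨a, b⟩, by rw [e, lift_apply_eq]⟩
  have h1 : σ x = Complex.lift ⟨J, hJ⟩ w * x := by rw [← hw, mul_assoc, hyx, mul_one]
  have h2 : x = Complex.lift ⟨J, hJ⟩ (w * w) * x := by
    calc x = σ (σ x) := (hσ.involutive x).symm
      _ = Complex.lift ⟨J, hJ⟩ w * (x * Complex.lift ⟨J, hJ⟩ (f w)) := by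
        rw [h1, hσ.map_mul, hσf, h1, mul_assoc]
      _ = _ := by rw [hxf, twist_twist hf, ← mul_assoc, map_mul]
  have h3 : Complex.lift ⟨J, hJ⟩ (w * w) = Complex.lift ⟨J, hJ⟩ 1 := by
    have h4 := congrArg (· * y) h2
    simp only [mul_assoc, hxy, mul_one] at h4
    rw [← h4, map_one]
  have h4 := (Complex.lift ⟨J, hJ⟩ : ℂ →ₐ[ℝ] D).toRingHom.injective h3
  rcases mul_self_eq_one_iff.1 h4 with e | e
  · left; rw [h1, e, map_one, one_mul]
  · right; rw [h1, e, map_neg, map_one, neg_one_mul]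

/-- A refinement with identity component `ℝ` is adapted to `σ` as soon as it has a homogeneous
element that is symmetric or skew and does not commute with the identity component of `𝒟`. -/
theorem IsRefinement.isAdapted_of_anticommuting (h : IsGradedDivision 𝒟)
    [FiniteDimensional ℝ D]
    {J : D} (hJD : J ∈ 𝒟 0) (hJ : J * J = -1) (hc : ∀ x ∈ 𝒟 0, J * x = x * J)
    {σ : D →ₗ[ℝ] D} (hσ : IsInvolution σ) (hσd : PreservesDegree 𝒟 σ)
    (hB : IsAlgebraGrading ℬ) (hr : IsRefinement ℬ 𝒟)
    (hR : ∀ x ∈ ℬ 0, ∃ r : ℝ, x = algebraMap ℝ D r) {k : H} (hJk : J ∈ ℬ k) {l : H} {z : D}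
    (hz : z ∈ ℬ l) (hz0 : z ≠ 0) (hzJ : z * J = -(J * z)) (hσz : σ z = z ∨ σ z = -z) :
    IsAdaptedRefinement 𝒟 σ (fun k : H × G => ℬ k.1 ⊓ 𝒟 k.2) := by
  have := h.nontrivial
  have hιD : ∀ w, Complex.lift ⟨J, hJ⟩ w ∈ 𝒟 0 := fun w => by
    rw [lift_apply_eq]
    exact (𝒟 0).add_mem (h.isGrading.algebraMap_mem _) ((𝒟 0).smul_mem _ hJD)
  have hι : ∀ x ∈ 𝒟 0, ∃ w, x = Complex.lift ⟨J, hJ⟩ w := fun x hx => by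
    obtain ⟨a, b, e⟩ := h.exists_eq_add_smul hJD hJ hc hx
    exact ⟨⟨a, b⟩, by rw [e, lift_apply_eq]⟩
  obtain ⟨f, hf, hσf⟩ : ∃ f : ℂ → ℂ, (f = id ∨ f = starRingEnd ℂ) ∧
      ∀ w, σ (Complex.lift ⟨J, hJ⟩ w) = Complex.lift ⟨J, hJ⟩ (f w) := by
    have h1 : σ J * σ J = -1 := by rw [← hσ.map_mul, hJ, map_neg, hσ.map_one]
    rcases h.eq_or_eq_neg_of_commute hJD (hσd 0 J hJD) hJ h1 (hc _ (hσd 0 J hJD)) with e | e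
    · exact ⟨id, Or.inl rfl, fun w => by
        simp only [lift_apply_eq, map_add, hσ.map_algebraMap, map_smul, e, id_eq]⟩
    · exact ⟨starRingEnd ℂ, Or.inr rfl, fun w => by
        simp only [lift_apply_eq, map_add, hσ.map_algebraMap, map_smul, e, Complex.conj_re,
          Complex.conj_im, smul_neg, neg_smul]⟩
  obtain ⟨gz, hgz⟩ := hr l
  have hzD := hgz hz
  obtain ⟨z', hz', hzz', hz'z⟩ := h.exists_inv hzD hz0
  have hz'B := hB.inv_mem hz hzz' hz'z
  have hfz : ∀ w, z * Complex.lift ⟨J, hJ⟩ w =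
      Complex.lift ⟨J, hJ⟩ (starRingEnd ℂ w) * z := fun w => by
    simp only [lift_apply_eq, Complex.conj_re, Complex.conj_im, mul_add, add_mul, mul_smul_comm,
      smul_mul_assoc, hzJ, Algebra.commutes, neg_smul, smul_neg, neg_mul]
  -- the refinement is invariant: replace `x` by `x * z` if necessary
  have hinv : ∀ i x, x ∈ ℬ i → σ x ∈ ℬ i := by
    intro i x hx
    obtain ⟨g, hg⟩ := hr i
    obtain ⟨fx, hfx, hxf⟩ := exists_twist_of_commute_or_anticommute hJ
      (h.commute_or_anticommute hJD hJ hc (hg hx))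
    have hpm : ∀ {j : H} {u v : D}, v ∈ ℬ j → (u = v ∨ u = -v) → u ∈ ℬ j := by
      rintro j u v hv (rfl | rfl)
      · exact hv
      · exact (ℬ j).neg_mem hv
    by_cases hff : fx = f
    · subst hff
      exact hpm hx (h.symm_or_skew_of_twist_eq hJD hJ hc hσ hσd hf hσf (hg hx) hxf)
    · have hff' : ∀ w, fx (starRingEnd ℂ w) = f w := by
        intro w
        rcases hf with rfl | rfl <;> rcases hfx with rfl | rfl <;> simp at hff ⊢
      have h1 := h.symm_or_skew_of_twist_eq hJD hJ hc hσ hσd hf hσf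
        (h.isGrading.mul_mem (hg hx) hzD)
        (fun w => by rw [mul_assoc, hfz, ← mul_assoc, hxf, hff', mul_assoc])
      have h2 : σ z * σ x ∈ ℬ (i + l) := by
        rw [← hσ.map_mul]; exact hpm (hB.mul_mem hx hz) h1
      have h3 : z * σ x ∈ ℬ (i + l) := by
        rcases hσz with e | e
        · rwa [e] at h2
        · rw [e, neg_mul] at h2; simpa using (ℬ _).neg_mem h2
      have h4 := hB.mul_mem hz'B h3
      rwa [← mul_assoc, hz'z, one_mul, neg_add_cancel_comm_assoc] at h4
  refine ⟨h.isGrading.inf_of_isRefinement hB hr, fun k => inf_le_right, ⟨J, hJD, fun hJ0 => ?_⟩,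
    fun i x hx => ⟨hinv _ _ hx.1, hσd _ _ hx.2⟩, ?_⟩
  · obtain ⟨r, e⟩ := hR J hJ0.1
    exact not_real_of_sq_eq_neg_one hJ r e
  intro g p hp hp0 hpσ
  obtain ⟨P, hP, hP1, hP2, hs, hPg⟩ :=
    hr.exists_projections hB.independent hB.iSup_eq_top h.isGrading.independent
  obtain ⟨i, hi⟩ : ∃ i, P i p ≠ 0 := by
    by_contra! hall
    obtain ⟨s, e⟩ := hs p
    exact hp0 (by rw [e]; exact Finset.sum_eq_zero fun i _ => hall i)
  have hxB := hP i p
  have hxD := hPg g i p hp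
  generalize P i p = x at hi hxB hxD
  obtain ⟨y, hy, hxy, hyx⟩ := h.exists_inv hxD hi
  obtain ⟨u, hu⟩ : ∃ u, p * y = Complex.lift ⟨J, hJ⟩ u := by
    refine hι _ ?_
    have h1 := h.isGrading.mul_mem hp hy
    rwa [add_neg_cancel] at h1
  obtain rfl : p = Complex.lift ⟨J, hJ⟩ u * x := by rw [← hu, mul_assoc, hyx, mul_one]
  have hu0 : u ≠ 0 := by rintro rfl; simp at hp0
  obtain ⟨fx, hfx, hxf⟩ := exists_twist_of_commute_or_anticommute hJ
    (h.commute_or_anticommute hJD hJ hc hxD)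
  by_cases hff : fx = f
  · -- the coefficient `u` can be removed by means of a square root of its inverse
    subst hff
    obtain ⟨v, hv⟩ : ∃ v : ℂ, v * v = u⁻¹ :=
      ⟨_, by rw [← pow_two]; exact Complex.cpow_nat_inv_pow (u⁻¹) two_ne_zero⟩
    have hv0 : v ≠ 0 := by
      rintro rfl; rw [mul_zero, eq_comm, inv_eq_zero] at hv; exact hu0 hv
    refine ⟨Complex.lift ⟨J, hJ⟩ (fx v), hιD _, ?_, (i, g), ?_⟩
    · intro e
      have := (map_eq_zero_iff _ (Complex.lift ⟨J, hJ⟩ : ℂ →ₐ[ℝ] D).toRingHom.injective).1 e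
      refine hv0 ?_
      rw [← twist_twist hf v, this]
      rcases hf with rfl | rfl <;> simp
    · have : σ (Complex.lift ⟨J, hJ⟩ (fx v)) * (Complex.lift ⟨J, hJ⟩ u * x) *
          Complex.lift ⟨J, hJ⟩ (fx v) = x := by
        rw [hσf, twist_twist hf, mul_assoc, mul_assoc, hxf, twist_twist hf, ← mul_assoc,
          ← mul_assoc, ← map_mul, ← map_mul, mul_comm v u, mul_assoc u, hv,
          mul_inv_cancel₀ hu0, map_one, one_mul]
      rw [this]
      exact ⟨hxB, hxD⟩
  · -- otherwise the coefficient `u` is real or purely imaginary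
    obtain ⟨r, hσx⟩ := hr.exists_eq_smul h hB hR hxB hi (hinv _ _ hxB)
    have hff' : ∀ w, fx (f w) = starRingEnd ℂ w := by
      intro w
      rcases hf with rfl | rfl <;> rcases hfx with rfl | rfl <;> simp at hff ⊢
    have h1 : σ (Complex.lift ⟨J, hJ⟩ u * x) =
        Complex.lift ⟨J, hJ⟩ ((r : ℂ) * starRingEnd ℂ u) * x := by
      rw [hσ.map_mul, hσf, hσx, smul_mul_assoc, hxf, hff', ← smul_mul_assoc, ← map_smul,
        Complex.real_smul]
    have h2 : ∃ s : ℝ, starRingEnd ℂ u * r = s * u := by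
      rw [h1] at hpσ
      have hcanc : ∀ a b : ℂ, Complex.lift ⟨J, hJ⟩ a * x = Complex.lift ⟨J, hJ⟩ b * x → a = b := by
        intro a b e
        have h4 := congrArg (· * y) e
        simp only [mul_assoc, hxy, mul_one] at h4
        exact (Complex.lift ⟨J, hJ⟩ : ℂ →ₐ[ℝ] D).toRingHom.injective h4
      rcases hpσ with e | e
      · exact ⟨1, by rw [mul_comm, hcanc _ _ e]; simp⟩
      · rw [← neg_mul, ← map_neg] at e
        exact ⟨-1, by rw [mul_comm, hcanc _ _ e]; simp⟩
    have hr0 : r ≠ 0 := by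
      rintro rfl
      rw [zero_smul] at hσx
      exact hi (by rw [← hσ.involutive x, hσx, map_zero])
    obtain ⟨s, hs⟩ := h2
    have hre := congrArg Complex.re hs
    have him := congrArg Complex.im hs
    simp at hre him
    have h3 : u.im = 0 ∨ u.re = 0 := by
      by_contra! hh
      have e1 : r = s := mul_left_cancel₀ hh.2 (by linarith)
      have e2 : -r = s := mul_left_cancel₀ hh.1 (by linarith)
      exact hr0 (by linarith)
    refine ⟨1, h.isGrading.one_mem, one_ne_zero, ?_⟩
    rw [hσ.map_one, one_mul, mul_one]
    rcases h3 with e | e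
    · refine ⟨(i, g), ?_, hp⟩
      rw [lift_apply_eq, e, zero_smul, add_zero, ← Algebra.smul_def]
      exact (ℬ i).smul_mem _ hxB
    · refine ⟨(k + i, g), ?_, hp⟩
      rw [lift_apply_eq, e, map_zero, zero_add, smul_mul_assoc]
      exact (ℬ _).smul_mem _ (hB.mul_mem hJk hxB)

end NonCentral

section Conj

variable {D G H : Type*} [Ring D] [Algebra ℝ D] [AddCommGroup G] [AddCommGroup H]
  {𝒟 : G → Submodule ℝ D} {ℬ : H → Submodule ℝ D}

/-- Gradings can be pulled back along automorphisms. -/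
theorem IsAlgebraGrading.comap (hB : IsAlgebraGrading ℬ) (e : D ≃ₐ[ℝ] D) :
    IsAlgebraGrading (fun k => (ℬ k).comap e.toLinearMap) where
  independent := by
    obtain ⟨P, -, hP1, hP2, -⟩ := exists_projections hB.independent hB.iSup_eq_top
    refine iSupIndep_of_separating fun k => ⟨P k ∘ₗ e.toLinearMap, fun x hx h0 => ?_,
      fun j hj x hx => hP2 _ _ _ hx hj.symm⟩
    rw [LinearMap.comp_apply, hP1 _ _ hx] at h0
    exact e.injective (h0.trans (map_zero e).symm)
  iSup_eq_top := by
    rw [eq_top_iff]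
    intro x _
    obtain ⟨P, hP, -, -, hs⟩ := exists_projections hB.independent hB.iSup_eq_top
    obtain ⟨s, hs⟩ := hs (e x)
    have h1 : x = ∑ i ∈ s, e.symm (P i (e x)) := by
      rw [← map_sum, ← hs, e.symm_apply_apply]
    rw [h1]
    refine Submodule.sum_mem _ fun i _ => Submodule.mem_iSup_of_mem i ?_
    change e (e.symm (P i (e x))) ∈ ℬ i
    rw [e.apply_symm_apply]
    exact hP _ _
  mul_mem := by
    intro k l x y hx hy
    change e (x * y) ∈ ℬ _
    rw [map_mul]
    exact hB.mul_mem hx hy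

/-- Conjugation `x ↦ y * x * z` for mutually inverse elements `y` and `z`. -/
def conjEquiv {y z : D} (hyz : y * z = 1) (hzy : z * y = 1) : D ≃ₐ[ℝ] D :=
  AlgEquiv.ofLinearEquiv
    { toFun := fun x => y * x * z
      map_add' := fun a b => by rw [mul_add, add_mul]
      map_smul' := fun r a => by simp
      invFun := fun x => z * x * y
      left_inv := fun x => by
        calc z * (y * x * z) * y = z * y * x * (z * y) := by simp only [mul_assoc]
          _ = x := by rw [hzy, one_mul, mul_one]
      right_inv := fun x => by
        calc y * (z * x * y) * z = y * z * x * (y * z) := by simp only [mul_assoc]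
          _ = x := by rw [hyz, one_mul, mul_one] }
    (by simp [hyz])
    (fun a b => by
      change y * (a * b) * z = y * a * z * (y * b * z)
      calc y * (a * b) * z = y * a * 1 * b * z := by simp only [mul_assoc, one_mul]
        _ = _ := by rw [← hzy]; simp only [mul_assoc])

/-- If the identity component is commutative but not central, a proper refinement becomes adapted
after conjugation by an element of the identity component. -/
theorem IsRefinement.exists_adapted_of_not_central (h : IsGradedDivision 𝒟)
    [FiniteDimensional ℝ D]
    {J : D} (hJD : J ∈ 𝒟 0) (hJ : J * J = -1) (hc : ∀ x ∈ 𝒟 0, J * x = x * J)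
    (hJc : ∃ x, x * J ≠ J * x)
    {σ : D →ₗ[ℝ] D} (hσ : IsInvolution σ) (hσd : PreservesDegree 𝒟 σ)
    (hB : IsAlgebraGrading ℬ) (hr : IsRefinement ℬ 𝒟)
    (hR : ∀ x ∈ ℬ 0, ∃ r : ℝ, x = algebraMap ℝ D r) {k : H} (hJk : J ∈ ℬ k) :
    ∃ C : H × G → Submodule ℝ D, IsAdaptedRefinement 𝒟 σ C := by
  have := h.nontrivial
  obtain ⟨l, x, hx, hxJ⟩ : ∃ l, ∃ x ∈ ℬ l, x * J ≠ J * x := by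
    by_contra! hall
    obtain ⟨x, hx⟩ := hJc
    exact hx (induction_of_iSup_eq_top (p := fun x => x * J = J * x) hB.iSup_eq_top hall
      (by simp) (fun a b ha hb => by rw [add_mul, mul_add, ha, hb]) x)
  obtain ⟨g, hg⟩ := hr l
  have hx0 : x ≠ 0 := by rintro rfl; simp at hxJ
  have hxa : x * J = -(J * x) := (h.commute_or_anticommute hJD hJ hc (hg hx)).resolve_left hxJ
  -- a symmetric or skew element in the same component of `𝒟`
  obtain ⟨z, hz, hz0, hσz⟩ : ∃ z ∈ 𝒟 g, z ≠ 0 ∧ (σ z = z ∨ σ z = -z) := by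
    by_cases h0 : x + σ x = 0
    · exact ⟨x, hg hx, hx0, Or.inr (eq_neg_of_add_eq_zero_right h0)⟩
    · exact ⟨x + σ x, (𝒟 g).add_mem (hg hx) (hσd g x (hg hx)), h0, Or.inl (by
        rw [map_add, hσ.involutive, add_comm])⟩
  obtain ⟨y, hy, hxy, hyx⟩ := h.exists_inv (hg hx) hx0
  obtain ⟨u, hu⟩ : ∃ u, z * y = Complex.lift ⟨J, hJ⟩ u := by
    have h1 := h.isGrading.mul_mem hz hy
    rw [add_neg_cancel] at h1
    obtain ⟨a, b, e⟩ := h.exists_eq_add_smul hJD hJ hc h1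
    exact ⟨⟨a, b⟩, by rw [e, lift_apply_eq]⟩
  have hzx : z = Complex.lift ⟨J, hJ⟩ u * x := by rw [← hu, mul_assoc, hyx, mul_one]
  have hu0 : u ≠ 0 := by rintro rfl; rw [map_zero, zero_mul] at hzx; exact hz0 hzx
  -- `v` is a square root of `u`, and conjugation by `v` turns `u * x` into a multiple of `x`
  obtain ⟨v, hv⟩ : ∃ v : ℂ, v * v = u :=
    ⟨_, by rw [← pow_two]; exact Complex.cpow_nat_inv_pow u two_ne_zero⟩
  have hv0 : v ≠ 0 := by rintro rfl; rw [mul_zero] at hv; exact hu0 hv.symm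
  have hιJ : ∀ w, Complex.lift ⟨J, hJ⟩ w * J = J * Complex.lift ⟨J, hJ⟩ w := fun w => by
    simp only [lift_apply_eq, add_mul, mul_add, smul_mul_assoc, mul_smul_comm, Algebra.commutes]
  have hιD : ∀ w, Complex.lift ⟨J, hJ⟩ w ∈ 𝒟 0 := fun w => by
    rw [lift_apply_eq]
    exact (𝒟 0).add_mem (h.isGrading.algebraMap_mem _) ((𝒟 0).smul_mem _ hJD)
  have hxι : ∀ w, x * Complex.lift ⟨J, hJ⟩ w =
      Complex.lift ⟨J, hJ⟩ (starRingEnd ℂ w) * x := fun w => by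
    simp only [lift_apply_eq, Complex.conj_re, Complex.conj_im, mul_add, add_mul, mul_smul_comm,
      smul_mul_assoc, hxa, Algebra.commutes, neg_smul, smul_neg, neg_mul]
  have h1 : Complex.lift ⟨J, hJ⟩ v⁻¹ * Complex.lift ⟨J, hJ⟩ v = 1 := by
    rw [← map_mul, inv_mul_cancel₀ hv0, map_one]
  have h2 : Complex.lift ⟨J, hJ⟩ v * Complex.lift ⟨J, hJ⟩ v⁻¹ = 1 := by
    rw [← map_mul, mul_inv_cancel₀ hv0, map_one]
  let e := conjEquiv h1 h2
  have he : ∀ a, e a = Complex.lift ⟨J, hJ⟩ v⁻¹ * a * Complex.lift ⟨J, hJ⟩ v := fun a => rfl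
  have hes : ∀ a, e.symm a = Complex.lift ⟨J, hJ⟩ v * a * Complex.lift ⟨J, hJ⟩ v⁻¹ :=
    fun a => rfl
  refine ⟨_, IsRefinement.isAdapted_of_anticommuting h hJD hJ hc hσ hσd (hB.comap e)
    (fun i => ?_) (fun a ha => ?_) (k := k) ?_ (l := l) (z := z) ?_ hz0 ?_ hσz⟩
  · obtain ⟨g', hg'⟩ := hr i
    refine ⟨g', fun a ha => ?_⟩
    have h3 := h.isGrading.mul_mem (h.isGrading.mul_mem (hιD v) (hg' ha)) (hιD v⁻¹)
    rw [zero_add, add_zero] at h3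
    rw [← e.symm_apply_apply a, hes]
    exact h3
  · obtain ⟨r, hr⟩ := hR _ ha
    refine ⟨r, e.injective ?_⟩
    rw [e.commutes]; exact hr
  · change e J ∈ ℬ k
    rw [he, mul_assoc, ← hιJ, ← mul_assoc, h1, one_mul]
    exact hJk
  · change e z ∈ ℬ l
    have h3 : e z = Complex.normSq v • x := by
      rw [he, hzx, mul_assoc, mul_assoc, hxι, ← mul_assoc, ← mul_assoc, ← map_mul, ← map_mul, ← hv,
        ← mul_assoc, inv_mul_cancel₀ hv0, one_mul, Complex.mul_conj, lift_apply_eq,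
        Complex.ofReal_re, Complex.ofReal_im, zero_smul, add_zero, ← Algebra.smul_def]
    rw [h3]
    exact (ℬ l).smul_mem _ hx
  · rw [hzx, mul_assoc, hxa, mul_neg, ← mul_assoc, hιJ, mul_assoc]

end Conj

/-! ### Central identity component -/

section Central

universe v

variable {D G : Type*} [Ring D] [Algebra ℝ D] [AddCommGroup G]
  {𝒟 : G → Submodule ℝ D}

/-- The group of homogeneous units that are symmetric or skew with respect to an involution `σ`,
when products of such elements are again symmetric or skew. -/
def symmOrSkewUnits (h : IsGradedDivision 𝒟) {σ : D →ₗ[ℝ] D} (hσ : IsInvolution σ)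
    (hmul : ∀ x y : D, (∃ g, x ∈ 𝒟 g) → (∃ g, y ∈ 𝒟 g) → (σ x = x ∨ σ x = -x) →
      (σ y = y ∨ σ y = -y) → σ (x * y) = x * y ∨ σ (x * y) = -(x * y)) : Subgroup Dˣ where
  carrier := {u | (∃ g, (u : D) ∈ 𝒟 g) ∧ (σ u = u ∨ σ u = -u)}
  mul_mem' := by
    rintro u v ⟨⟨g, hg⟩, hu⟩ ⟨⟨k, hk⟩, hv⟩
    refine ⟨⟨g + k, ?_⟩, ?_⟩
    · rw [Units.val_mul]; exact h.isGrading.mul_mem hg hk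
    · rw [Units.val_mul]; exact hmul _ _ ⟨g, hg⟩ ⟨k, hk⟩ hu hv
  one_mem' := ⟨⟨0, h.isGrading.one_mem⟩, Or.inl hσ.map_one⟩
  inv_mem' := by
    rintro u ⟨⟨g, hg⟩, hu⟩
    refine ⟨⟨-g, h.isGrading.inv_mem hg u.mul_inv u.inv_mul⟩, ?_⟩
    have h1 : σ ↑u⁻¹ * σ u = 1 := by rw [← hσ.map_mul, u.mul_inv, hσ.map_one]
    rcases hu with e | e
    · left; rw [e] at h1; exact (Units.inv_eq_of_mul_eq_one_left h1).symm
    · right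
      rw [e, mul_neg, ← neg_mul] at h1
      rw [← neg_neg (σ _)]
      exact congrArg _ (Units.inv_eq_of_mul_eq_one_left h1).symm

/-- If the identity component is central and `σ` acts on it as complex conjugation, and
homogeneous elements commute up to real factors, then the decomposition of the components into
symmetric and skew elements is an adapted refinement. Its degrees form the group of
symmetric and skew homogeneous units modulo the real scalars. -/
theorem IsGradedDivision.exists_adapted_of_central {D : Type v} [Ring D] [Algebra ℝ D]
    [FiniteDimensional ℝ D] {𝒟 : G → Submodule ℝ D} (h : IsGradedDivision 𝒟)
    {J : D} (hJD : J ∈ 𝒟 0) (hJ : J * J = -1) (hJc : ∀ x, J * x = x * J)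
    {σ : D →ₗ[ℝ] D} (hσ : IsInvolution σ) (hσd : PreservesDegree 𝒟 σ) (hσJ : σ J = -J)
    (hcomm : ∀ g k, ∀ x ∈ 𝒟 g, ∀ y ∈ 𝒟 k, ∃ r : ℝ, y * x = r • (x * y)) :
    ∃ (Q : Type v) (_ : AddCommGroup Q) (C : Q × G → Submodule ℝ D),
      IsAdaptedRefinement 𝒟 σ C := by
  have := h.nontrivial
  have hmul : ∀ x y : D, (∃ g, x ∈ 𝒟 g) → (∃ g, y ∈ 𝒟 g) → (σ x = x ∨ σ x = -x) →
      (σ y = y ∨ σ y = -y) → σ (x * y) = x * y ∨ σ (x * y) = -(x * y) := by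
    rintro x y ⟨g, hx⟩ ⟨k, hy⟩ hσx hσy
    obtain ⟨r, hr⟩ := hcomm g k x hx y hy
    obtain ⟨s, hs⟩ : ∃ s : ℝ, σ (x * y) = s • (x * y) := by
      rw [hσ.map_mul]
      rcases hσx with e | e <;> rcases hσy with e' | e' <;> rw [e, e']
      · exact ⟨r, hr⟩
      · exact ⟨-r, by rw [neg_mul, hr, neg_smul]⟩
      · exact ⟨-r, by rw [mul_neg, hr, neg_smul]⟩
      · exact ⟨r, by rw [neg_mul_neg, hr]⟩
    by_cases h0 : x * y = 0
    · left; rw [h0, map_zero]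
    have h1 : (s * s - 1) • (x * y) = 0 := by
      have h2 := hσ.involutive (x * y)
      rw [hs, map_smul, hs, smul_smul] at h2
      rw [sub_smul, h2, one_smul, sub_self]
    have h2 := (smul_eq_zero.1 h1).resolve_right h0
    rcases mul_self_eq_one_iff.1 (sub_eq_zero.1 h2) with e | e
    · left; rw [hs, e, one_smul]
    · right; rw [hs, e, neg_smul, one_smul]
  let N := symmOrSkewUnits h hσ hmul
  let M : Subgroup N :=
    { carrier := {u | ∃ r : ℝ, ((u : Dˣ) : D) = algebraMap ℝ D r}
      mul_mem' := by
        rintro u v ⟨r, hr⟩ ⟨s, hs⟩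
        exact ⟨r * s, by simp [hr, hs]⟩
      one_mem' := ⟨1, by simp⟩
      inv_mem' := by
        rintro u ⟨r, hr⟩
        refine ⟨r⁻¹, ?_⟩
        have h1 : ((u : Dˣ) : D) * ((u⁻¹ : Dˣ) : D) = 1 := Units.mul_inv _
        have hr0 : r ≠ 0 := by
          rintro rfl
          rw [hr, map_zero, zero_mul] at h1
          exact zero_ne_one h1
        rw [hr] at h1
        have h2 : algebraMap ℝ D r⁻¹ * algebraMap ℝ D r = 1 := by
          rw [← map_mul, inv_mul_cancel₀ hr0, map_one]
        calc (((u⁻¹ : N) : Dˣ) : D) = algebraMap ℝ D r⁻¹ * algebraMap ℝ D r * ((u⁻¹ : Dˣ) : D) := by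
              rw [h2, one_mul]; rfl
          _ = _ := by rw [mul_assoc, h1, mul_one] }
  have hMn : M.Normal := ⟨by
    rintro u ⟨r, hr⟩ v
    refine ⟨r, ?_⟩
    calc (((v * u * v⁻¹ : N) : Dˣ) : D) = (v : Dˣ) * ((u : Dˣ) : D) * ((v⁻¹ : Dˣ) : D) := by
          simp
      _ = _ := by rw [hr, ← Algebra.commutes, mul_assoc, Units.mul_inv, mul_one]⟩
  have hQc : ∀ a b : N ⧸ M, a * b = b * a := by
    intro a b
    induction a using QuotientGroup.induction_on with | H u =>
    induction b using QuotientGroup.induction_on with | H v =>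
    rw [← QuotientGroup.mk_mul, ← QuotientGroup.mk_mul, QuotientGroup.eq]
    obtain ⟨⟨g, hg⟩, -⟩ := u.2
    obtain ⟨⟨k, hk⟩, -⟩ := v.2
    obtain ⟨r, hr⟩ := hcomm g k _ hg _ hk
    refine ⟨r, ?_⟩
    have h1 : (((u * v)⁻¹ * (v * u) : N) : Dˣ) = (u * v : Dˣ)⁻¹ * (v * u : Dˣ) := rfl
    rw [h1, Units.val_mul, Units.val_mul (v : Dˣ), hr, mul_smul_comm, ← Units.val_mul (u : Dˣ),
      Units.inv_mul, Algebra.algebraMap_eq_smul_one]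
  let _ : CommGroup (N ⧸ M) := { (inferInstance : Group (N ⧸ M)) with mul_comm := hQc }
  have hN : ∀ g, ∀ x ∈ 𝒟 g, x ≠ 0 → (σ x = x ∨ σ x = -x) → ∃ u : N, ((u : Dˣ) : D) = x := by
    intro g x hx hx0 hσx
    obtain ⟨u, rfl⟩ := h.isUnit g x hx hx0
    exact ⟨⟨u, ⟨g, hx⟩, hσx⟩, rfl⟩
  have hmk : ∀ u v : N, (u : N ⧸ M) = v ↔ ∃ r : ℝ, r ≠ 0 ∧ ((v : Dˣ) : D) = r • ((u : Dˣ) : D) := by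
    intro u v
    rw [QuotientGroup.eq]
    have h1 : (((u⁻¹ * v : N) : Dˣ) : D) = ((u⁻¹ : Dˣ) : D) * ((v : Dˣ) : D) := rfl
    constructor
    · rintro ⟨r, hr⟩
      rw [h1] at hr
      have h2 : ((v : Dˣ) : D) = r • ((u : Dˣ) : D) := by
        rw [Algebra.smul_def, Algebra.commutes, ← hr, ← mul_assoc, Units.mul_inv, one_mul]
      refine ⟨r, ?_, h2⟩
      rintro rfl
      rw [zero_smul] at h2
      exact (v : Dˣ).ne_zero h2
    · rintro ⟨r, -, hr⟩
      exact ⟨r, by rw [h1, hr, mul_smul_comm, Units.inv_mul, Algebra.algebraMap_eq_smul_one]⟩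
  -- the real line spanned by a class of units
  let C : Additive (N ⧸ M) → Submodule ℝ D := fun q =>
    { carrier := {x | x = 0 ∨ ∃ u : N, Additive.ofMul (u : N ⧸ M) = q ∧ ((u : Dˣ) : D) = x}
      zero_mem' := Or.inl rfl
      add_mem' := by
        rintro x y (rfl | ⟨u, hu, rfl⟩) hy
        · rwa [zero_add]
        rcases hy with rfl | ⟨v, hv, rfl⟩
        · rw [add_zero]; exact Or.inr ⟨u, hu, rfl⟩
        obtain ⟨r, -, hr⟩ := (hmk u v).1 (Additive.ofMul.injective (hu.trans hv.symm))
        rw [hr]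
        by_cases h0 : ((u : Dˣ) : D) + r • ((u : Dˣ) : D) = 0
        · exact Or.inl h0
        · right
          have h1 : ((u : Dˣ) : D) + r • ((u : Dˣ) : D) = (1 + r) • ((u : Dˣ) : D) := by
            rw [add_smul, one_smul]
          rw [h1] at h0 ⊢
          obtain ⟨⟨g, hg⟩, hσu⟩ := u.2
          obtain ⟨w, hw⟩ := hN g _ ((𝒟 g).smul_mem (1 + r) hg) h0 (by
            rw [map_smul]
            rcases hσu with e | e
            · left; rw [e]
            · right; rw [e, smul_neg])
          refine ⟨w, ?_, hw⟩
          rw [← hu, (hmk u w).2 ⟨1 + r, fun e => h0 (by rw [e, zero_smul]), hw⟩]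
      smul_mem' := by
        rintro r x (rfl | ⟨u, hu, rfl⟩)
        · rw [smul_zero]; exact Or.inl rfl
        by_cases h0 : r • ((u : Dˣ) : D) = 0
        · exact Or.inl h0
        · right
          obtain ⟨⟨g, hg⟩, hσu⟩ := u.2
          obtain ⟨w, hw⟩ := hN g _ ((𝒟 g).smul_mem r hg) h0 (by
            rw [map_smul]
            rcases hσu with e | e
            · left; rw [e]
            · right; rw [e, smul_neg])
          exact ⟨w, by rw [← hu, (hmk u w).2 ⟨r, fun e => h0 (by rw [e, zero_smul]), hw⟩], hw⟩ }
  have hCmem : ∀ g, ∀ x ∈ 𝒟 g, (σ x = x ∨ σ x = -x) → ∃ q, x ∈ C q := by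
    intro g x hx hσx
    by_cases h0 : x = 0
    · exact ⟨0, Or.inl h0⟩
    · obtain ⟨u, hu⟩ := hN g x hx h0 hσx
      exact ⟨_, Or.inr ⟨u, rfl, hu⟩⟩
  have hσC : ∀ q x, x ∈ C q → σ x = x ∨ σ x = -x := by
    rintro q x (rfl | ⟨u, -, rfl⟩)
    · left; rw [map_zero]
    · exact u.2.2
  -- symmetric (or skew) units of the same degree are proportional
  have hprop : ∀ (s : ℝ) g (u v : N), ((u : Dˣ) : D) ∈ 𝒟 g → ((v : Dˣ) : D) ∈ 𝒟 g →
      σ ((u : Dˣ) : D) = s • ((u : Dˣ) : D) → σ ((v : Dˣ) : D) = s • ((v : Dˣ) : D) →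
      (u : N ⧸ M) = v := by
    intro s g u v hu hv hσu hσv
    have h1 := h.isGrading.mul_mem hv (h.isGrading.inv_mem hu (u : Dˣ).mul_inv (u : Dˣ).inv_mul)
    rw [add_neg_cancel] at h1
    obtain ⟨a, b, hab⟩ := h.exists_eq_add_smul hJD hJ (fun x _ => hJc x) h1
    have h2 : ((v : Dˣ) : D) = (algebraMap ℝ D a + b • J) * ((u : Dˣ) : D) := by
      rw [← hab, mul_assoc, Units.inv_mul, mul_one]
    have h3 : σ ((v : Dˣ) : D) = s • ((algebraMap ℝ D a - b • J) * ((u : Dˣ) : D)) := by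
      rw [h2, hσ.map_mul, hσu, map_add, hσ.map_algebraMap, map_smul, hσJ, smul_neg,
        ← sub_eq_add_neg, smul_mul_assoc, mul_sub, sub_mul, Algebra.commutes, mul_smul_comm,
        ← hJc, smul_mul_assoc]
    have hs : s ≠ 0 := by
      rintro rfl
      rw [zero_smul] at hσu
      exact (u : Dˣ).ne_zero (by rw [← hσ.involutive ((u : Dˣ) : D), hσu, map_zero])
    rw [hσv, h2] at h3
    have h4 := (u : Dˣ).isUnit.mul_right_cancel (smul_right_injective D hs h3)
    have h5 : b • J = 0 := by
      have h6 : (2 : ℝ) • (b • J) = 0 := by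
        rw [two_smul]
        rw [sub_eq_add_neg] at h4
        exact add_eq_zero_iff_eq_neg.2 (add_left_cancel h4)
      exact (smul_eq_zero.1 h6).resolve_left two_ne_zero
    rw [h5, add_zero, ← Algebra.smul_def] at h2
    refine (hmk u v).2 ⟨a, ?_, h2⟩
    rintro rfl
    rw [zero_smul] at h2
    exact (v : Dˣ).ne_zero h2
  have hgr : IsAlgebraGrading (fun k : Additive (N ⧸ M) × G => C k.1 ⊓ 𝒟 k.2) := by
    refine h.isGrading.inf ?_ ?_ ?_
    · obtain ⟨P, hP, hP1, hP2, -⟩ :=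
        exists_projections h.isGrading.independent h.isGrading.iSup_eq_top
      refine iSupIndep_of_separating (N := D) fun q => ?_
      by_cases hq : ∃ x ∈ C q, x ≠ 0
      · obtain ⟨x, hxq | ⟨u, hu, rfl⟩, hx0⟩ := hq
        · exact absurd hxq hx0
        obtain ⟨⟨g, hg⟩, hσu⟩ := u.2
        obtain ⟨s, hs, hσu⟩ : ∃ s : ℝ, s * s = 1 ∧ σ ((u : Dˣ) : D) = s • ((u : Dˣ) : D) := by
          rcases hσu with e | e
          · exact ⟨1, by norm_num, by rw [e, one_smul]⟩
          · exact ⟨-1, by norm_num, by rw [e, neg_one_smul]⟩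
        refine ⟨(LinearMap.id + s • σ) ∘ₗ P g, ?_, ?_⟩
        · rintro x (rfl | ⟨v, hv, rfl⟩) hx0
          · rfl
          exfalso
          obtain ⟨r, hr0, hr⟩ := (hmk u v).1 (Additive.ofMul.injective (hu.trans hv.symm))
          rw [hr, LinearMap.comp_apply, map_smul, hP1 _ _ hg, LinearMap.add_apply,
            LinearMap.smul_apply, LinearMap.id_apply, map_smul, hσu, smul_comm r s, smul_smul s s,
            hs, one_smul, ← two_smul ℝ] at hx0
          exact (u : Dˣ).ne_zero ((smul_eq_zero.1 ((smul_eq_zero.1 hx0).resolve_left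
            two_ne_zero)).resolve_left hr0)
        · rintro q' hq' x (rfl | ⟨v, hv, rfl⟩)
          · rw [map_zero]
          rw [LinearMap.comp_apply]
          obtain ⟨⟨k, hk⟩, hσv⟩ := v.2
          by_cases hgk : g = k
          · subst hgk
            rw [hP1 _ _ hk, LinearMap.add_apply, LinearMap.smul_apply, LinearMap.id_apply]
            have hne : σ ((v : Dˣ) : D) ≠ s • ((v : Dˣ) : D) := fun e =>
              hq' (by rw [← hv, ← hu, hprop s g u v hg hk hσu e])
            rcases mul_self_eq_one_iff.1 hs with rfl | rfl
            · rw [one_smul] at hne ⊢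
              rw [hσv.resolve_left hne, add_neg_cancel]
            · rw [neg_one_smul] at hne ⊢
              rw [hσv.resolve_right hne, add_neg_cancel]
          · rw [hP2 _ _ _ hk hgk, map_zero]
      · push Not at hq
        exact ⟨0, fun x hx _ => hq x hx, fun _ _ _ _ => rfl⟩
    · rintro k l x y (rfl | ⟨u, hu, rfl⟩) hy
      · rw [zero_mul]; exact Or.inl rfl
      rcases hy with rfl | ⟨v, hv, rfl⟩
      · rw [mul_zero]; exact Or.inl rfl
      exact Or.inr ⟨u * v, by rw [← hu, ← hv]; rfl, rfl⟩
    · intro g x hx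
      have h1 : x = (2⁻¹ : ℝ) • (x + σ x) + (2⁻¹ : ℝ) • (x - σ x) := by
        rw [← smul_add, add_add_sub_cancel, ← two_smul ℝ x, smul_smul]; norm_num
      have h2 : x + σ x ∈ 𝒟 g := (𝒟 g).add_mem hx (hσd g x hx)
      have h3 : x - σ x ∈ 𝒟 g := (𝒟 g).sub_mem hx (hσd g x hx)
      obtain ⟨q, hq⟩ := hCmem g _ h2 (Or.inl (by rw [map_add, hσ.involutive, add_comm]))
      obtain ⟨q', hq'⟩ := hCmem g _ h3 (Or.inr (by rw [map_sub, hσ.involutive, neg_sub]))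
      rw [h1]
      exact Submodule.add_mem _
        (Submodule.smul_mem _ _ (Submodule.mem_iSup_of_mem q ⟨hq, h2⟩))
        (Submodule.smul_mem _ _ (Submodule.mem_iSup_of_mem q' ⟨hq', h3⟩))
  refine ⟨Additive (N ⧸ M), inferInstance, _, hgr, fun k => inf_le_right, ⟨J, hJD, ?_⟩, ?_, ?_⟩
  · rintro ⟨hJ0 | ⟨u, hu, hJu⟩, -⟩
    · exact not_real_of_sq_eq_neg_one hJ 0 (by rw [hJ0, map_zero])
    · have h1 : ((1 : N) : N ⧸ M) = u := (Additive.ofMul.injective hu).symm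
      obtain ⟨r, -, hr⟩ := (hmk 1 u).1 h1
      refine not_real_of_sq_eq_neg_one hJ r ?_
      rw [← hJu, hr, Algebra.algebraMap_eq_smul_one]; rfl
  · rintro ⟨q, g⟩ x ⟨hx1, hx2⟩
    refine ⟨?_, hσd g x hx2⟩
    rcases hσC q x hx1 with e | e
    · rw [e]; exact hx1
    · rw [e]; exact (C q).neg_mem hx1
  · intro g p hp hp0 hσp
    obtain ⟨q, hq⟩ := hCmem g p hp hσp
    exact ⟨1, h.isGrading.one_mem, one_ne_zero, (q, g), by
      rw [hσ.map_one, one_mul, mul_one]; exact ⟨hq, hp⟩⟩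

end Central

open MulOpposite

/-! ### Graded modules over graded-division algebras -/

section GradedModules

variable {F D G V : Type*} [Field F] [Ring D] [Algebra F D] [AddCommGroup G]
  [AddCommGroup V] [Module F V] [Module Dᵐᵒᵖ V]
  {𝒟 : G → Submodule F D} {𝒱 : G → Submodule F V}

theorem IsRightModuleGrading.projection_smul (hD : IsAlgebraGrading 𝒟)
    (hV : IsRightModuleGrading 𝒟 𝒱) {P : G → D →ₗ[F] D} {Q : G → V →ₗ[F] V}
    (hP1 : ∀ i x, x ∈ 𝒟 i → P i x = x) (hP2 : ∀ i j x, x ∈ 𝒟 i → j ≠ i → P j x = 0)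
    (hQ1 : ∀ i x, x ∈ 𝒱 i → Q i x = x) (hQ2 : ∀ i j x, x ∈ 𝒱 i → j ≠ i → Q j x = 0)
    {γ : G} {v : V} (hv : v ∈ 𝒱 γ) (g : G) (d : D) :
    Q (γ + g) (op d • v) = op (P g d) • v := by
  refine induction_of_iSup_eq_top hD.iSup_eq_top (p := fun d => Q (γ + g) (op d • v) =
    op (P g d) • v) (fun k d hd => ?_) (by simp) (fun x y hx hy => by
      rw [op_add, add_smul, map_add, hx, hy, map_add, op_add, add_smul]) d
  by_cases hk : g = k
  · subst hk
    rw [hQ1 _ _ (hV.smul_mem hv hd), hP1 _ _ hd]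
  · rw [hQ2 _ _ _ (hV.smul_mem hv hd) fun e => hk (add_left_cancel e), hP2 _ _ _ hd hk, op_zero,
      zero_smul]

/-- A nonzero homogeneous vector of a graded module over a graded-division algebra that lies
outside the span of a set of homogeneous vectors intersects this span trivially. -/
theorem IsRightModuleGrading.eq_zero_of_smul_mem_span (hD : IsGradedDivision 𝒟)
    (hV : IsRightModuleGrading 𝒟 𝒱) {s : Set V} (hs : ∀ x ∈ s, ∃ g, x ∈ 𝒱 g) {γ : G} {v : V}
    (hv : v ∈ 𝒱 γ) (hvs : v ∉ Submodule.span Dᵐᵒᵖ s) {d : D}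
    (hd : op d • v ∈ Submodule.span Dᵐᵒᵖ s) : d = 0 := by
  obtain ⟨P, hP, hP1, hP2, hPs⟩ :=
    exists_projections hD.isGrading.independent hD.isGrading.iSup_eq_top
  obtain ⟨Q, hQ, hQ1, hQ2, -⟩ := exists_projections hV.independent hV.iSup_eq_top
  have hspan : ∀ g, ∀ x ∈ Submodule.span Dᵐᵒᵖ s, Q g x ∈ Submodule.span Dᵐᵒᵖ s := by
    intro g x hx
    induction hx using Submodule.closure_induction with
    | zero => simp
    | add x y _ _ hx hy => rw [map_add]; exact Submodule.add_mem _ hx hy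
    | smul_mem r x hx =>
      obtain ⟨k, hk⟩ := hs x hx
      have := hV.projection_smul hD.isGrading hP1 hP2 hQ1 hQ2 hk (g - k) (unop r)
      rw [add_sub_cancel, op_unop] at this
      rw [this]
      exact Submodule.smul_mem _ _ (Submodule.subset_span hx)
  obtain ⟨t, ht⟩ := hPs d
  rw [ht]
  refine Finset.sum_eq_zero fun g _ => ?_
  by_contra h0
  have h1 := hspan (γ + g) _ hd
  rw [hV.projection_smul hD.isGrading hP1 hP2 hQ1 hQ2 hv] at h1
  obtain ⟨y, -, hxy, -⟩ := hD.exists_inv (hP g d) h0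
  have h2 := Submodule.smul_mem _ (op y) h1
  rw [smul_smul, ← op_mul, hxy, op_one, one_smul] at h2
  exact hvs h2

/-- A nonzero homogeneous vector `v` has a homogeneous dual functional: `v` can be completed to a
homogeneous basis. -/
theorem IsRightModuleGrading.exists_functional (hD : IsGradedDivision 𝒟)
    (hV : IsRightModuleGrading 𝒟 𝒱) {γ : G} {v : V} (hv : v ∈ 𝒱 γ) (hv0 : v ≠ 0) :
    ∃ l : V →ₗ[Dᵐᵒᵖ] D, l v = 1 ∧ ∀ h x, x ∈ 𝒱 h → l x ∈ 𝒟 (h - γ) := by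
  have hDn := hD.nontrivial
  have hsing : ∀ {s : Set V}, (∀ x ∈ s, ∃ g, x ∈ 𝒱 g) → LinearIndepOn Dᵐᵒᵖ id s → ∀ {k : G} {x : V},
      x ∈ 𝒱 k → x ∉ Submodule.span Dᵐᵒᵖ s → LinearIndepOn Dᵐᵒᵖ id (s ∪ {x}) := by
    intro s hs hli k x hx hxs
    refine hli.union (LinearIndepOn.singleton' fun r hr => ?_) ?_
    · have h1 := hV.eq_zero_of_smul_mem_span hD hs hx hxs (d := unop r) (by
        rw [op_unop]; rw [id] at hr; rw [hr]; exact Submodule.zero_mem _)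
      rw [← op_unop r, h1, op_zero]
    · rw [Set.image_id, Set.image_singleton, Submodule.disjoint_def]
      intro y hy hy'
      obtain ⟨r, rfl⟩ := Submodule.mem_span_singleton.1 hy'
      have h1 := hV.eq_zero_of_smul_mem_span hD hs hx hxs (d := unop r) hy
      rw [← op_unop r, h1, op_zero, zero_smul]
  obtain ⟨s, hvs, hs⟩ := zorn_subset_nonempty
    {s : Set V | (∀ x ∈ s, ∃ g, x ∈ 𝒱 g) ∧ LinearIndepOn Dᵐᵒᵖ id s} (by
      intro c hc hcc _
      refine ⟨⋃₀ c, ⟨?_, ?_⟩, fun t ht => Set.subset_sUnion_of_mem ht⟩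
      · rintro x ⟨t, ht, hxt⟩
        exact (hc ht).1 x hxt
      · exact linearIndepOn_sUnion_of_directed hcc.directedOn fun t ht => (hc ht).2)
    {v} ⟨by rintro x rfl; exact ⟨γ, hv⟩, by
      have := hsing (s := ∅) (by simp) (linearIndepOn_empty _ _) hv (by simpa using hv0)
      rwa [Set.empty_union] at this⟩
  have hspan : Submodule.span Dᵐᵒᵖ s = ⊤ := by
    rw [eq_top_iff]
    intro x _
    refine induction_of_iSup_eq_top (p := fun x => x ∈ Submodule.span Dᵐᵒᵖ s) hV.iSup_eq_top
      (fun g x hx => ?_) (Submodule.zero_mem _) (fun x y => Submodule.add_mem _) x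
    by_contra hxs
    have h1 := hs.2 (y := s ∪ {x}) ⟨?_, hsing hs.1.1 hs.1.2 hx hxs⟩ Set.subset_union_left
    · exact hxs (Submodule.subset_span (h1 (Or.inr rfl)))
    · rintro y (hy | rfl)
      · exact hs.1.1 y hy
      · exact ⟨g, hx⟩
  have hli : LinearIndependent Dᵐᵒᵖ (fun x : s => (x : V)) := hs.1.2
  let b : Module.Basis s Dᵐᵒᵖ V := Module.Basis.mk hli (by
    rw [show Set.range (fun x : s => (x : V)) = s from Subtype.range_coe, hspan])
  have hb : ∀ a : s, b a = a := fun a => Module.Basis.mk_apply _ _ a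
  choose deg hdeg using fun a : s => hs.1.1 a a.2
  have hv' : v ∈ s := hvs rfl
  let v' : s := ⟨v, hv'⟩
  obtain ⟨P, hP, hP1, hP2, hPs⟩ :=
    exists_projections hD.isGrading.independent hD.isGrading.iSup_eq_top
  obtain ⟨Q, hQ, hQ1, hQ2, -⟩ := exists_projections hV.independent hV.iSup_eq_top
  have hγ : deg v' = γ := by
    by_contra h0
    exact hv0 (eq_zero_of_iSupIndep hV.independent h0 (hdeg v') hv)
  -- the coordinates of homogeneous components are homogeneous components of coordinates
  have hcoord : ∀ g x a, unop (b.repr (Q g x) a) = P (g - deg a) (unop (b.repr x a)) := by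
    intro g x a
    have h1 : x ∈ Submodule.span Dᵐᵒᵖ s := by rw [hspan]; trivial
    induction h1 using Submodule.closure_induction with
    | zero => simp
    | add x y _ _ hx hy => simp [hx, hy]
    | smul_mem r x hx =>
      have h2 := hV.projection_smul hD.isGrading hP1 hP2 hQ1 hQ2 (hdeg ⟨x, hx⟩)
        (g - deg ⟨x, hx⟩) (unop r)
      rw [add_sub_cancel, op_unop] at h2
      have h3 : b.repr x = Finsupp.single (⟨x, hx⟩ : s) 1 := by
        rw [← b.repr_self, hb]
      rw [h2, map_smul, map_smul, h3, Finsupp.smul_apply, Finsupp.smul_apply]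
      by_cases hax : (⟨x, hx⟩ : s) = a
      · subst hax; simp
      · simp [Finsupp.single_eq_of_ne' hax]
  refine ⟨{ toFun := fun x => unop (b.repr x v')
            map_add' := fun x y => by simp
            map_smul' := fun r x => by simp }, ?_, fun h x hx => ?_⟩
  · change unop (b.repr (v' : V) v') = 1
    rw [← hb, b.repr_self]; simp
  · change unop (b.repr x v') ∈ _
    rw [← hQ1 _ _ hx, hcoord, hγ]
    exact hP _ _

end GradedModules

/-! ### The hermitian form of a degree-preserving involution -/

section Form

variable {D G V : Type*} [Ring D] [Algebra ℝ D] [AddCommGroup G]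
  [AddCommGroup V] [Module ℝ V] [Module Dᵐᵒᵖ V] [IsScalarTower ℝ Dᵐᵒᵖ V]
  {𝒟 : G → Submodule ℝ D} {𝒱 : G → Submodule ℝ V}

/-- `B` is a nondegenerate graded `ε`-hermitian form of degree `-δ` on the right `D`-module `V`,
with respect to an involution `σ` of `D`, and `φ` is the adjunction of `B`. The form is linear in
the second argument; its `σ`-semilinearity in the first one follows from the hermitian symmetry. -/
structure IsHermitianForm (𝒟 : G → Submodule ℝ D) (𝒱 : G → Submodule ℝ V)
    (φ : Module.End Dᵐᵒᵖ V →ₗ[ℝ] Module.End Dᵐᵒᵖ V) (σ : D →ₗ[ℝ] D) (B : V →ₗ[ℝ] V →ₗ[ℝ] D)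
    (ε : ℝ) (δ : G) : Prop where
  involution : IsInvolution σ
  preservesDegree : PreservesDegree 𝒟 σ
  sign : ε = 1 ∨ ε = -1
  smul_right : ∀ x y d, B x (op d • y) = B x y * d
  hermitian : ∀ x y, B y x = ε • σ (B x y)
  adjoint : ∀ (r : Module.End Dᵐᵒᵖ V) x y, B (r x) y = B x (φ r y)
  nondegenerate : ∀ x, (∀ y, B x y = 0) → x = 0
  homogeneous : ∀ g k x y, x ∈ 𝒱 g → y ∈ 𝒱 k → B x y ∈ 𝒟 (g + k - δ)

/-- The endomorphism `x ↦ u * l x` for a vector `u` and a functional `l`, as a linear function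
of `u`. -/
def rankOne (l : V →ₗ[Dᵐᵒᵖ] D) : V →ₗ[ℝ] Module.End Dᵐᵒᵖ V where
  toFun u :=
    { toFun := fun x => op (l x) • u
      map_add' := fun x y => by rw [map_add, op_add, add_smul]
      map_smul' := fun r x => by
        rw [map_smul, RingHom.id_apply, smul_smul, ← op_unop r, op_smul_eq_mul, op_mul] }
  map_add' u v := by
    ext x
    exact smul_add _ _ _
  map_smul' r u := by
    ext x
    exact smul_comm _ _ _

theorem rankOne_apply (l : V →ₗ[Dᵐᵒᵖ] D) (u x : V) : rankOne l u x = op (l x) • u := rfl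

theorem mul_rankOne (l : V →ₗ[Dᵐᵒᵖ] D) (r : Module.End Dᵐᵒᵖ V) (u : V) :
    r * rankOne l u = rankOne l (r u) := by
  ext x
  exact map_smul r _ _

theorem rankOne_mem_endGrading (hV : IsRightModuleGrading 𝒟 𝒱) {l : V →ₗ[Dᵐᵒᵖ] D} {γ k : G}
    (hl : ∀ h x, x ∈ 𝒱 h → l x ∈ 𝒟 (h - γ)) {u : V} (hu : u ∈ 𝒱 k) :
    rankOne l u ∈ endGrading D 𝒱 (k - γ) := by
  intro h x hx
  have := hV.smul_mem hu (hl h x hx)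
  rwa [rankOne_apply, show k - γ + h = k + (h - γ) by abel]

/-- The adjoint of a homogeneous projection of rank one is again a projection of rank one onto
a homogeneous line. -/
theorem exists_adjoint_line (hD : IsGradedDivision 𝒟) (hV : IsRightModuleGrading 𝒟 𝒱)
    {φ : Module.End Dᵐᵒᵖ V →ₗ[ℝ] Module.End Dᵐᵒᵖ V} (hφ : IsInvolution φ)
    (hφdeg : PreservesDegree (endGrading D 𝒱) φ) {γ : G} {v : V} (hv : v ∈ 𝒱 γ) (hv0 : v ≠ 0)
    {l : V →ₗ[Dᵐᵒᵖ] D} (hlv : l v = 1) (hl : ∀ h x, x ∈ 𝒱 h → l x ∈ 𝒟 (h - γ)) :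
    ∃ (κ : G) (w : V) (m : V →ₗ[Dᵐᵒᵖ] D), w ∈ 𝒱 κ ∧ m w = 1 ∧
      (∀ h x, x ∈ 𝒱 h → m x ∈ 𝒟 (h - κ)) ∧ φ (rankOne l v) w = w ∧
      ∀ x, φ (rankOne l v) x = op (m (φ (rankOne l v) x)) • w := by
  have := hD.nontrivial
  set e := rankOne l v with he
  set f := φ e with hf
  have hev : e v = v := by rw [he, rankOne_apply, hlv, op_one, one_smul]
  have hee : e * e = e := by
    conv_lhs => rw [he]
    rw [mul_rankOne, ← he, hev]
  have hff : f * f = f := by rw [hf, ← hφ.map_mul, hee]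
  have hf0 : f ≠ 0 := fun h0 => hv0 (by
    have h1 : e = 0 := by rw [← hφ.involutive e, ← hf, h0, map_zero]
    rw [← hev, h1]; rfl)
  have heD : e ∈ endGrading D 𝒱 0 := by
    have := rankOne_mem_endGrading hV hl hv
    rwa [sub_self] at this
  have hfD : f ∈ endGrading D 𝒱 0 := hφdeg 0 e heD
  obtain ⟨κ, u, hu, hfu⟩ : ∃ κ, ∃ u ∈ 𝒱 κ, f u ≠ 0 := by
    by_contra! hall
    refine hf0 (LinearMap.ext fun x => ?_)
    exact induction_of_iSup_eq_top (p := fun x => f x = 0) hV.iSup_eq_top hall (map_zero f)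
      (fun x y hx hy => by rw [map_add, hx, hy, add_zero]) x
  have hw : f u ∈ 𝒱 κ := by have := hfD κ u hu; rwa [zero_add] at this
  have hfw : f (f u) = f u := by
    conv_rhs => rw [← hff]
    rfl
  generalize f u = w at hfu hw hfw
  obtain ⟨m, hmw, hm⟩ := hV.exists_functional hD hw hfu
  refine ⟨κ, w, m, hw, hmw, hm, hfw, ?_⟩
  set π := rankOne m w with hπ
  have hπw : π w = w := by rw [hπ, rankOne_apply, hmw, op_one, one_smul]
  have hfπ : f * π = π := by rw [hπ, mul_rankOne, hfw]
  have hππ : π * π = π := by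
    conv_lhs => rw [hπ]
    rw [mul_rankOne, ← hπ, hπw]
  have hπD : π ∈ endGrading D 𝒱 0 := by
    have := rankOne_mem_endGrading hV hm hw
    rwa [sub_self] at this
  -- the idempotent `π * f` corresponds to an idempotent of the identity component of `D`
  have h1 : φ (π * f) = rankOne l (op (l (φ π v)) • v) := by
    have h2 : φ π = φ π * e := by
      conv_lhs => rw [← hfπ]
      rw [hφ.map_mul, hf, hφ.involutive]
    calc φ (π * f) = e * (φ π * e) := by rw [hφ.map_mul, hf, hφ.involutive, ← h2]
      _ = rankOne l (e (φ π v)) := by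
        conv_lhs => rw [he, mul_rankOne, ← he, mul_rankOne]
      _ = _ := rfl
  set c := l (φ π v) with hc
  have hcD : c ∈ 𝒟 0 := by
    have h2 := hφdeg 0 π hπD γ v hv
    have h3 := hl _ _ h2
    rwa [zero_add, sub_self] at h3
  have hcc : c * c = c := by
    have h2 : φ (π * f) * φ (π * f) = φ (π * f) := by
      rw [← hφ.map_mul]
      congr 1
      calc π * f * (π * f) = π * (f * π) * f := by simp only [mul_assoc]
        _ = π * f := by rw [hfπ, hππ]
    have h3 := congrArg (fun r : Module.End Dᵐᵒᵖ V => l (r v)) h2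
    simpa [h1, rankOne_apply, hlv] using h3
  have hc0 : c ≠ 0 := by
    intro h0
    rw [h0, op_zero, zero_smul, map_zero] at h1
    have h2 : π * f = 0 := by rw [← hφ.involutive (π * f), h1, map_zero]
    have h3 : (π * f) w = w := by rw [Module.End.mul_apply, hfw, hπw]
    rw [h2] at h3
    exact hfu h3.symm
  have hc1 : c = 1 := by
    have h2 : c * (c - 1) = 0 := by rw [mul_sub, hcc, mul_one, sub_self]
    exact sub_eq_zero.1 ((hD.mul_eq_zero hcD hc0).1 h2)
  rw [hc1, op_one, one_smul, ← he] at h1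
  have h2 : π * f = f := by rw [← hφ.involutive (π * f), h1]
  intro x
  conv_lhs => rw [← h2]
  rfl

/-- A degree-preserving involution of `End_D(V)` is the adjunction of a nondegenerate graded
sesquilinear form; `z` measures the failure of symmetry. -/
theorem exists_sesquilinear_form (hD : IsGradedDivision 𝒟) (hV : IsRightModuleGrading 𝒟 𝒱)
    [Nontrivial V] {φ : Module.End Dᵐᵒᵖ V →ₗ[ℝ] Module.End Dᵐᵒᵖ V} (hφ : IsInvolution φ)
    (hφdeg : PreservesDegree (endGrading D 𝒱) φ) :
    ∃ (σ : D →ₗ[ℝ] D) (B : V →ₗ[ℝ] V →ₗ[ℝ] D) (δ : G) (z : D),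
      (∀ x y, σ (x * y) = σ y * σ x) ∧ PreservesDegree 𝒟 σ ∧
      (∀ x y d, B x (op d • y) = B x y * d) ∧
      (∀ x y, B y x = σ (B x y) * z) ∧
      (∀ (r : Module.End Dᵐᵒᵖ V) x y, B (r x) y = B x (φ r y)) ∧
      (∀ x, (∀ y, B x y = 0) → x = 0) ∧
      (∀ g k x y, x ∈ 𝒱 g → y ∈ 𝒱 k → B x y ∈ 𝒟 (g + k - δ)) ∧
      z ∈ 𝒟 0 ∧ σ z * z = 1 ∧ (∀ d, ∃ x y, B x y = d) := by
  obtain ⟨γ, v, hv, hv0⟩ : ∃ γ, ∃ v ∈ 𝒱 γ, v ≠ 0 := by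
    by_contra! hall
    obtain ⟨x, hx⟩ := exists_ne (0 : V)
    exact hx (induction_of_iSup_eq_top (p := fun x => x = 0) hV.iSup_eq_top hall rfl
      (fun x y hx hy => by rw [hx, hy, add_zero]) x)
  obtain ⟨l, hlv, hl⟩ := hV.exists_functional hD hv hv0
  obtain ⟨κ, w, m, hw, hmw, hm, hfw, hf⟩ := exists_adjoint_line hD hV hφ hφdeg hv hv0 hlv hl
  let B : V →ₗ[ℝ] V →ₗ[ℝ] D := LinearMap.mk₂ ℝ (fun x y => m (φ (rankOne l x) y))
    (fun x x' y => by simp) (fun r x y => by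
      simp only [map_smul, LinearMap.smul_apply]
      exact LinearMap.map_smul_of_tower m r _)
    (fun x y y' => by simp) (fun r x y => by
      rw [LinearMap.map_smul_of_tower, LinearMap.map_smul_of_tower])
  have hB : ∀ x y, B x y = m (φ (rankOne l x) y) := fun x y => rfl
  have hE : ∀ x, rankOne l x * rankOne l v = rankOne l x := fun x => by
    rw [mul_rankOne, rankOne_apply, hlv, op_one, one_smul]
  -- the adjoints of the operators `rankOne l x` have values in the line of `w`
  have hφE : ∀ x y, φ (rankOne l x) y = op (B x y) • w := fun x y => by
    have h1 : φ (rankOne l x) = φ (rankOne l v) * φ (rankOne l x) := by rw [← hφ.map_mul, hE]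
    rw [hB, h1, Module.End.mul_apply]
    exact hf _
  have hBr : ∀ x y d, B x (op d • y) = B x y * d := fun x y d => by
    rw [hB, map_smul, map_smul]; rfl
  let σ : D →ₗ[ℝ] D :=
    { toFun := fun d => B (op d • v) w
      map_add' := fun a b => by rw [op_add, add_smul, map_add, LinearMap.add_apply]
      map_smul' := fun r a => by
        rw [op_smul, smul_assoc, map_smul, LinearMap.smul_apply, RingHom.id_apply] }
  have hσ : ∀ d, σ d = B (op d • v) w := fun d => rfl
  have hBl : ∀ x y d, B (op d • x) y = σ d * B x y := fun x y d => by
    have h1 : rankOne l (op d • x) = rankOne l x * rankOne l (op d • v) := by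
      rw [mul_rankOne, rankOne_apply, LinearMap.map_smul l, hlv, op_smul_eq_mul, one_mul]
    have h2 : φ (rankOne l (op d • x)) y = op (σ d * B x y) • w := by
      rw [h1, hφ.map_mul, Module.End.mul_apply, hφE x y, map_smul, hφE _ w, smul_smul, ← op_mul, hσ]
    rw [hB, h2, map_smul, hmw, op_smul_eq_mul, one_mul]
  have hBhom : ∀ g k x y, x ∈ 𝒱 g → y ∈ 𝒱 k → B x y ∈ 𝒟 (g + k - (γ + κ)) := by
    intro g k x y hx hy
    have h1 := hφdeg _ _ (rankOne_mem_endGrading hV hl hx) k y hy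
    have h2 := hm _ _ h1
    rwa [show g - γ + k - κ = g + k - (γ + κ) by abel] at h2
  have hBad : ∀ (r : Module.End Dᵐᵒᵖ V) x y, B (r x) y = B x (φ r y) := fun r x y => by
    rw [hB, hB, ← mul_rankOne, hφ.map_mul]; rfl
  have hvw : B v w = 1 := by rw [hB, hfw, hmw]
  have hσm : ∀ x y, σ (x * y) = σ y * σ x := fun x y => by
    rw [hσ (x * y), op_mul, mul_smul, hBl, hσ x]
  have hherm : ∀ x y, B y x = σ (B x y) * B w v := fun x y => by
    have h1 : φ (rankOne l (op (B x y) • w)) = φ (rankOne l y) * rankOne l x := by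
      rw [← hφE, ← mul_rankOne, hφ.map_mul, hφ.involutive]
    have h2 := congrArg (fun r : Module.End Dᵐᵒᵖ V => m (r v)) h1
    simp only [Module.End.mul_apply] at h2
    rw [← hB, hBl, rankOne_apply, hlv, op_one, one_smul, ← hB] at h2
    exact h2.symm
  refine ⟨σ, B, γ + κ, B w v, hσm, fun g d hd => ?_, hBr, hherm, hBad, fun x hx => ?_, hBhom, ?_,
    ?_, fun d => ⟨v, op d • w, by rw [hBr, hvw, one_mul]⟩⟩
  · have h1 := hBhom _ _ _ _ (hV.smul_mem hv hd) hw
    rwa [show γ + g + κ - (γ + κ) = g by abel] at h1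
  · have h1 : φ (rankOne l x) = 0 := LinearMap.ext fun y => by
      rw [hφE, hx y, op_zero, zero_smul]; rfl
    have h2 : rankOne l x = 0 := by rw [← hφ.involutive (rankOne l x), h1, map_zero]
    have h3 : rankOne l x v = x := by rw [rankOne_apply, hlv, op_one, one_smul]
    rw [← h3, h2]; rfl
  · have h1 := hBhom _ _ _ _ hw hv
    rwa [show κ + γ - (γ + κ) = 0 by abel] at h1
  · rw [← hherm, hvw]

/-- A degree-preserving involution of `End_D(V)` is the adjunction of a nondegenerate graded
hermitian or skew-hermitian form. -/
theorem exists_isHermitianForm (hD : IsGradedDivision 𝒟) (hV : IsRightModuleGrading 𝒟 𝒱)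
    [Nontrivial V] {φ : Module.End Dᵐᵒᵖ V →ₗ[ℝ] Module.End Dᵐᵒᵖ V} (hφ : IsInvolution φ)
    (hφdeg : PreservesDegree (endGrading D 𝒱) φ) :
    ∃ (σ : D →ₗ[ℝ] D) (B : V →ₗ[ℝ] V →ₗ[ℝ] D) (ε : ℝ) (δ : G),
      IsHermitianForm 𝒟 𝒱 φ σ B ε δ := by
  have := hD.nontrivial
  obtain ⟨σ, B, δ, z, hσm, hσd, hBr, hherm, hBad, hBnd, hBhom, hz, hσz, hsurj⟩ :=
    exists_sesquilinear_form hD hV hφ hφdeg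
  have hz0 : z ≠ 0 := by rintro rfl; rw [mul_zero] at hσz; exact zero_ne_one hσz
  have hzσ : z * σ z = 1 := by
    obtain ⟨y, -, hy1, hy2⟩ := hD.exists_inv hz hz0
    have : σ z = y := by
      calc σ z = σ z * (z * y) := by rw [hy1, mul_one]
        _ = y := by rw [← mul_assoc, hσz, one_mul]
    rw [this, hy1]
  have hσσ : ∀ d, σ z * σ (σ d) * z = d := fun d => by
    obtain ⟨x, y, rfl⟩ := hsurj d
    conv_rhs => rw [hherm y x, hherm x y, hσm]
  have hσσ' : ∀ d, σ (σ d) = z * d * σ z := fun d => by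
    conv_rhs => rw [← hσσ d]
    calc σ (σ d) = (z * σ z) * σ (σ d) * (z * σ z) := by rw [hzσ, one_mul, mul_one]
      _ = _ := by simp only [mul_assoc]
  have hσ1 : σ 1 = 1 := by
    have h1 := hσm (σ (1 : D)) 1
    rw [mul_one, hσσ' 1, mul_one, hzσ, mul_one] at h1
    exact h1.symm
  -- rescaling the form by `c` turns `z` into the sign `ε`
  obtain ⟨c, ε, hε, hcD, hc0, hc⟩ : ∃ (c : D) (ε : ℝ), (ε = 1 ∨ ε = -1) ∧ c ∈ 𝒟 0 ∧ c ≠ 0 ∧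
      ε • σ c = z * c := by
    by_cases h1 : z = -1
    · exact ⟨1, -1, Or.inr rfl, hD.isGrading.one_mem, one_ne_zero, by rw [hσ1, h1]; simp⟩
    · refine ⟨1 + σ z, 1, Or.inl rfl, (𝒟 0).add_mem hD.isGrading.one_mem (hσd 0 z hz), ?_, ?_⟩
      · intro h0
        apply h1
        have h2 : z * (1 + σ z) = z + 1 := by rw [mul_add, hzσ, mul_one]
        rw [h0, mul_zero] at h2
        exact eq_neg_of_add_eq_zero_left h2.symm
      · rw [one_smul, map_add, hσ1, hσσ', mul_assoc, hzσ, mul_one, mul_add, hzσ, mul_one, add_comm]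
  obtain ⟨b, hb, hcb, hbc⟩ := hD.exists_inv hcD hc0
  rw [neg_zero] at hb
  have hεε : ε * ε = 1 := by rcases hε with rfl | rfl <;> norm_num
  have hσc : σ c = ε • (z * c) := by rw [← hc, smul_smul, hεε, one_smul]
  have hσb : c * σ b = ε • σ z := by
    have h1 : ε • (z * (c * σ b)) = 1 := by
      rw [← mul_assoc, ← smul_mul_assoc, ← hσc, ← hσm, hbc, hσ1]
    calc c * σ b = (ε * ε) • (σ z * z * (c * σ b)) := by rw [hεε, one_smul, hσz, one_mul]
      _ = ε • (σ z * (ε • (z * (c * σ b)))) := by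
        simp only [mul_smul, mul_assoc, mul_smul_comm]
      _ = ε • σ z := by rw [h1, mul_one]
  refine ⟨LinearMap.mulLeft ℝ c ∘ₗ LinearMap.mulRight ℝ b ∘ₗ σ,
    B.compr₂ (LinearMap.mulLeft ℝ c), ε, δ, ⟨?_, ?_⟩, ?_, hε, ?_, ?_, ?_, ?_, ?_⟩
  · intro x y
    change c * (σ (x * y) * b) = c * (σ y * b) * (c * (σ x * b))
    rw [hσm]
    calc c * (σ y * σ x * b) = c * σ y * 1 * (σ x * b) := by simp only [mul_assoc, one_mul]
      _ = _ := by rw [← hbc]; simp only [mul_assoc]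
  · intro x
    change c * (σ (c * (σ x * b)) * b) = x
    rw [hσm, hσm, hσc]
    calc c * (σ b * σ (σ x) * (ε • (z * c)) * b) = ε • (c * σ b * σ (σ x) * z * (c * b)) := by
          simp only [mul_smul_comm, smul_mul_assoc, mul_assoc]
      _ = x := by
        rw [hσb, hcb, mul_one, smul_mul_assoc, smul_mul_assoc, smul_smul, hεε, one_smul, hσσ]
  · intro g d hd
    change c * (σ d * b) ∈ 𝒟 g
    simpa using hD.isGrading.mul_mem hcD (hD.isGrading.mul_mem (hσd g d hd) hb)
  · intro x y d
    change c * B x (op d • y) = c * B x y * d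
    rw [hBr, mul_assoc]
  · intro x y
    change c * B y x = ε • (c * (σ (c * B x y) * b))
    rw [hherm x y, hσm, hσc]
    calc c * (σ (B x y) * z) = (ε * ε) • (c * (σ (B x y) * z) * (c * b)) := by
          rw [hεε, one_smul, hcb, mul_one]
      _ = _ := by simp only [mul_smul_comm, smul_mul_assoc, mul_assoc, mul_smul]
  · intro r x y
    exact congrArg (c * ·) (hBad r x y)
  · intro x hx
    exact hBnd x fun y => (hD.mul_eq_zero hcD hc0).1 (hx y)
  · intro g k x y hx hy
    have := hD.isGrading.mul_mem hcD (hBhom g k x y hx hy)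
    rwa [zero_add] at this

end Form

/-! ### Orthogonalization -/

section MonomialFamily

variable {D G V : Type*} [Ring D] [Algebra ℝ D] [AddCommGroup V] [Module ℝ V]
  {𝒱 : G → Submodule ℝ V} {B : V →ₗ[ℝ] V →ₗ[ℝ] D}

/-- The Gram matrix of the homogeneous family `v` is monomial with respect to the involutive
permutation `s` of the indices, and its nonzero entries belong to `P`. -/
structure IsMonomialFamily (𝒱 : G → Submodule ℝ V) (B : V →ₗ[ℝ] V →ₗ[ℝ] D) (P : Set D)
    {ι : Type*} (v : ι → V) (s : ι → ι) : Prop where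
  homogeneous : ∀ a, ∃ g, v a ∈ 𝒱 g
  involutive : ∀ a, s (s a) = a
  eq_zero : ∀ a b, b ≠ s a → B (v a) (v b) = 0
  mem : ∀ a, B (v a) (v (s a)) ∈ P
  ne_zero : ∀ a, B (v a) (v (s a)) ≠ 0

theorem IsMonomialFamily.linearIndependent {P : Set D}
    {ι : Type*} {v : ι → V} {s : ι → ι} (hv : IsMonomialFamily 𝒱 B P v s) :
    LinearIndependent ℝ v := by
  classical
  rw [linearIndependent_iff']
  intro t r hr a ha
  have h1 : B (v (s a)) (∑ b ∈ t, r b • v b) = r a • B (v (s a)) (v a) := by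
    rw [map_sum, Finset.sum_eq_single a, map_smul]
    · intro b _ hb
      rw [map_smul, hv.eq_zero _ _ (by rwa [hv.involutive]), smul_zero]
    · intro h0; exact absurd ha h0
  rw [hr, map_zero] at h1
  have h2 := hv.ne_zero (s a)
  rw [hv.involutive] at h2
  exact (smul_eq_zero.1 h1.symm).resolve_right h2

end MonomialFamily

section Orthogonal

variable {D G V : Type*} [Ring D] [Algebra ℝ D] [AddCommGroup G]
  [AddCommGroup V] [Module ℝ V] [Module Dᵐᵒᵖ V] [IsScalarTower ℝ Dᵐᵒᵖ V]
  {𝒟 : G → Submodule ℝ D} {𝒱 : G → Submodule ℝ V}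
  {φ : Module.End Dᵐᵒᵖ V →ₗ[ℝ] Module.End Dᵐᵒᵖ V} {σ : D →ₗ[ℝ] D} {B : V →ₗ[ℝ] V →ₗ[ℝ] D}
  {ε : ℝ} {δ : G}

theorem IsHermitianForm.smul_left (h : IsHermitianForm 𝒟 𝒱 φ σ B ε δ) (x y : V) (d : D) :
    B (op d • x) y = σ d * B x y := by
  rw [h.hermitian y, h.smul_right, h.involution.map_mul, h.hermitian y x, mul_smul_comm]

theorem IsHermitianForm.eq_zero_symm (h : IsHermitianForm 𝒟 𝒱 φ σ B ε δ) {x y : V}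
    (hxy : B x y = 0) : B y x = 0 := by
  rw [h.hermitian x, hxy, map_zero, smul_zero]

theorem IsHermitianForm.eq_of_forall (h : IsHermitianForm 𝒟 𝒱 φ σ B ε δ) {x y : V}
    (hxy : ∀ u, B u x = B u y) : x = y :=
  sub_eq_zero.1 (h.nondegenerate _ fun u => h.eq_zero_symm (by rw [map_sub, hxy, sub_self]))

theorem IsHermitianForm.map_self (h : IsHermitianForm 𝒟 𝒱 φ σ B ε δ) (x : V) :
    σ (B x x) = B x x ∨ σ (B x x) = -B x x := by
  have h1 := h.hermitian x x
  rcases h.sign with rfl | rfl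
  · left; rw [one_smul] at h1; exact h1.symm
  · right; rw [neg_one_smul] at h1; exact (neg_eq_iff_eq_neg.1 h1.symm)

/-- If the scalars are the only symmetric central elements of `End_D(V)`, they are the only
symmetric central elements of `D` of degree `0`. -/
theorem IsHermitianForm.central [Nontrivial V] (hD : IsGradedDivision 𝒟)
    (h : IsHermitianForm 𝒟 𝒱 φ σ B ε δ)
    (hφ : ∀ x ∈ Subalgebra.center ℝ (Module.End Dᵐᵒᵖ V), φ x = x →
      ∃ c : ℝ, x = algebraMap ℝ _ c)
    {c : D} (hcD : c ∈ 𝒟 0) (hc : ∀ x, c * x = x * c) (hσc : σ c = c) :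
    ∃ r : ℝ, c = algebraMap ℝ D r := by
  let ρ : Module.End Dᵐᵒᵖ V :=
    { toFun := fun x => op c • x
      map_add' := fun x y => smul_add _ _ _
      map_smul' := fun d x => by
        rw [RingHom.id_apply, smul_smul, smul_smul, ← op_unop d, ← op_mul, ← op_mul, hc] }
  have hρ : ∀ x, ρ x = op c • x := fun _ => rfl
  obtain ⟨r, hr⟩ := hφ ρ
    (Subalgebra.mem_center_iff.2 fun f => LinearMap.ext fun x => map_smul f _ _)
    (LinearMap.ext fun y => h.eq_of_forall fun x => by
      rw [← h.adjoint, hρ, h.smul_left, hσc, hρ, h.smul_right, hc])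
  refine ⟨r, ?_⟩
  by_contra hne
  obtain ⟨x, hx⟩ := exists_ne (0 : V)
  have h1 : op (c - algebraMap ℝ D r) • x = 0 := by
    have h2 : op c • x = r • x := by rw [← hρ, hr]; rfl
    rw [op_sub, sub_smul, h2, sub_eq_zero, Algebra.algebraMap_eq_smul_one, op_smul, op_one,
      smul_assoc, one_smul]
  obtain ⟨y, -, hy, -⟩ := hD.exists_inv ((𝒟 0).sub_mem hcD (hD.isGrading.algebraMap_mem r))
    (sub_ne_zero.2 hne)
  refine hx ?_
  rw [← one_smul Dᵐᵒᵖ x, ← op_one, ← hy, op_mul, mul_smul, h1, smul_zero]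

/-- Homogeneous components of a vector orthogonal to a homogeneous vector are orthogonal to it. -/
theorem IsHermitianForm.map_projection_eq_zero (hD : IsGradedDivision 𝒟)
    (hV : IsRightModuleGrading 𝒟 𝒱) (h : IsHermitianForm 𝒟 𝒱 φ σ B ε δ)
    {Q : G → V →ₗ[ℝ] V} (hQ1 : ∀ i x, x ∈ 𝒱 i → Q i x = x)
    (hQ2 : ∀ i j x, x ∈ 𝒱 i → j ≠ i → Q j x = 0) {k : G} {v x : V} (hv : v ∈ 𝒱 k)
    (hx : B v x = 0) (g : G) : B v (Q g x) = 0 := by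
  obtain ⟨P, hP, hP1, hP2, -⟩ :=
    exists_projections hD.isGrading.independent hD.isGrading.iSup_eq_top
  have h1 : ∀ x, B v (Q g x) = P (k + g - δ) (B v x) := by
    refine induction_of_iSup_eq_top hV.iSup_eq_top (fun i x hx => ?_) (by simp)
      (fun x y hx hy => by simp only [map_add, hx, hy])
    have h2 := h.homogeneous _ _ _ _ hv hx
    by_cases hi : g = i
    · subst hi
      rw [hQ1 _ _ hx, hP1 _ _ h2]
    · rw [hQ2 _ _ _ hx hi, map_zero, hP2 _ _ _ h2 fun e => hi ?_]
      simpa using e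
  rw [h1, hx, map_zero]

/-- The step of the orthogonalization process: a monomial family with a nonzero vector orthogonal
to it can be enlarged by an anisotropic vector or by a hyperbolic pair. -/
theorem IsMonomialFamily.exists_larger (hD : IsGradedDivision 𝒟)
    (hV : IsRightModuleGrading 𝒟 𝒱) (h : IsHermitianForm 𝒟 𝒱 φ σ B ε δ) {P : Set D}
    (hP1 : 1 ∈ P) (hPε : ε • 1 ∈ P)
    (hP : ∀ g, ∀ p ∈ 𝒟 g, p ≠ 0 → (σ p = p ∨ σ p = -p) →
      ∃ d ∈ 𝒟 0, d ≠ 0 ∧ σ d * p * d ∈ P)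
    {ι : Type} [Fintype ι] {v : ι → V} {s : ι → ι} (hv : IsMonomialFamily 𝒱 B P v s) {x : V}
    (hx0 : x ≠ 0) (hx : ∀ a, B (v a) x = 0) :
    ∃ (κ : Type) (_ : Fintype κ) (v' : κ → V) (s' : κ → κ), IsMonomialFamily 𝒱 B P v' s' ∧
      Fintype.card ι < Fintype.card κ := by
  classical
  have := hD.nontrivial
  obtain ⟨Q, hQ, hQ1, hQ2, hQs⟩ := exists_projections hV.independent hV.iSup_eq_top
  choose deg hdeg using hv.homogeneous
  obtain ⟨g, u, hu, hu0, huv⟩ : ∃ g, ∃ u ∈ 𝒱 g, u ≠ 0 ∧ ∀ a, B (v a) u = 0 := by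
    by_contra! hall
    obtain ⟨t, ht⟩ := hQs x
    refine hx0 ?_
    rw [ht]
    refine Finset.sum_eq_zero fun g _ => ?_
    by_contra h0
    obtain ⟨a, ha⟩ := hall g _ (hQ g x) h0
    exact ha (h.map_projection_eq_zero hD hV hQ1 hQ2 (hdeg a) (hx a) g)
  by_cases han : ∃ g, ∃ u ∈ 𝒱 g, B u u ≠ 0 ∧ ∀ a, B (v a) u = 0
  · obtain ⟨g, u, hu, hBu, huv⟩ := han
    have hBD := h.homogeneous _ _ _ _ hu hu
    obtain ⟨d, hd, hd0, hdP⟩ := hP _ _ hBD hBu (h.map_self u)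
    have hBd : B (op d • u) (op d • u) = σ d * B u u * d := by
      rw [h.smul_left, h.smul_right, mul_assoc]
    have hvd : ∀ a, B (v a) (op d • u) = 0 := fun a => by rw [h.smul_right, huv, zero_mul]
    have hσd0 : σ d ≠ 0 := fun e => hd0 (by rw [← h.involution.involutive d, e, map_zero])
    refine ⟨Option ι, inferInstance, fun o => o.elim (op d • u) v, Option.map s,
      ⟨?_, ?_, ?_, ?_, ?_⟩, by simp⟩
    · rintro (_ | a)
      · exact ⟨g, by have := hV.smul_mem hu hd; rwa [add_zero] at this⟩
      · exact hv.homogeneous a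
    · rintro (_ | a)
      · rfl
      · simp [hv.involutive]
    · rintro (_ | a) (_ | b) hab
      · simp at hab
      · exact h.eq_zero_symm (hvd b)
      · exact hvd a
      · exact hv.eq_zero a b (by simpa using hab)
    · rintro (_ | a)
      · change B (op d • u) (op d • u) ∈ P
        rwa [hBd]
      · exact hv.mem a
    · rintro (_ | a)
      · change B (op d • u) (op d • u) ≠ 0
        rw [hBd]
        exact fun e => hd0 ((hD.mul_eq_zero (hD.isGrading.mul_mem (h.preservesDegree _ _ hd) hBD)
          (hD.mul_ne_zero (h.preservesDegree _ _ hd) hσd0 hBu)).1 e)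
      · exact hv.ne_zero a
  · push Not at han
    have hiso : ∀ g u, u ∈ 𝒱 g → (∀ a, B (v a) u = 0) → B u u = 0 := by
      intro g u hu huv
      by_contra h0
      obtain ⟨a, ha⟩ := han g u hu h0
      exact ha (huv a)
    obtain ⟨k, y, hy, hBy⟩ : ∃ k, ∃ y ∈ 𝒱 k, B u y ≠ 0 := by
      by_contra! hall
      exact hu0 (h.nondegenerate _ (induction_of_iSup_eq_top hV.iSup_eq_top hall (map_zero _)
        (fun x y hx hy => by rw [map_add, hx, hy, add_zero])))
    choose q hq hpq hqp using fun a =>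
      hD.exists_inv (h.homogeneous _ _ _ _ (hdeg a) (hdeg (s a))) (hv.ne_zero a)
    -- project `y` to the orthogonal complement of the family
    set y' := y - ∑ a, op (q a * B (v a) y) • v (s a) with hy'
    have hy'V : y' ∈ 𝒱 k := by
      refine (𝒱 k).sub_mem hy (Submodule.sum_mem _ fun a _ => ?_)
      have h1 := hV.smul_mem (hdeg (s a)) (hD.isGrading.mul_mem (hq a)
        (h.homogeneous _ _ _ _ (hdeg a) hy))
      rwa [show deg (s a) + (-(deg a + deg (s a) - δ) + (deg a + k - δ)) = k by abel] at h1
    have hy'v : ∀ b, B (v b) y' = 0 := by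
      intro b
      rw [hy', map_sub, map_sum, Finset.sum_eq_single b, h.smul_right, ← mul_assoc, hpq, one_mul,
        sub_self]
      · intro a _ hab
        rw [h.smul_right, hv.eq_zero b (s a), zero_mul]
        intro e
        exact hab (by rw [← hv.involutive a, e, hv.involutive])
      · simp
    have hBy' : B u y' = B u y := by
      rw [hy', map_sub, map_sum, Finset.sum_eq_zero, sub_zero]
      intro a _
      rw [h.smul_right, h.eq_zero_symm (huv (s a)), zero_mul]
    rw [← hBy'] at hBy
    obtain ⟨c, hc, hc1, -⟩ := hD.exists_inv (h.homogeneous _ _ _ _ hu hy'V) hBy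
    have hwV := hV.smul_mem hy'V hc
    have hwv : ∀ a, B (v a) (op c • y') = 0 := fun a => by rw [h.smul_right, hy'v, zero_mul]
    have huw : B u (op c • y') = 1 := by rw [h.smul_right, hc1]
    have hww := hiso _ _ hwV hwv
    have huu := hiso _ _ hu huv
    generalize op c • y' = w at hwV hwv huw hww
    have hwu : B w u = ε • 1 := by rw [h.hermitian u, huw, h.involution.map_one]
    have hε : ε ≠ 0 := by rcases h.sign with e | e <;> rw [e] <;> norm_num
    refine ⟨ι ⊕ Bool, inferInstance, Sum.elim v fun b => cond b u w, Sum.map s not,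
      ⟨?_, ?_, ?_, ?_, ?_⟩, by simp⟩
    · rintro (a | _ | _)
      · exact hv.homogeneous a
      · exact ⟨_, hwV⟩
      · exact ⟨_, hu⟩
    · rintro (a | b)
      · simp [hv.involutive]
      · simp
    · rintro (a | _ | _) (b | _ | _) hab
      · exact hv.eq_zero a b (by simpa using hab)
      · exact hwv a
      · exact huv a
      · exact h.eq_zero_symm (hwv b)
      · exact hww
      · simp at hab
      · exact h.eq_zero_symm (huv b)
      · simp at hab
      · exact huu
    · rintro (a | _ | _)
      · exact hv.mem a
      · change B w u ∈ P
        rwa [hwu]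
      · change B u w ∈ P
        rwa [huw]
    · rintro (a | _ | _)
      · exact hv.ne_zero a
      · change B w u ≠ 0
        rw [hwu]
        exact smul_ne_zero hε one_ne_zero
      · change B u w ≠ 0
        rw [huw]
        exact one_ne_zero

/-- A graded hermitian form has a homogeneous basis with monomial Gram matrix whose entries belong
to `P`, if `P` contains the signs and all symmetric or skew homogeneous elements can be moved
to `P`. -/
theorem IsHermitianForm.exists_monomial_basis [FiniteDimensional ℝ V] (hD : IsGradedDivision 𝒟)
    (hV : IsRightModuleGrading 𝒟 𝒱) (h : IsHermitianForm 𝒟 𝒱 φ σ B ε δ) {P : Set D}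
    (hP1 : 1 ∈ P) (hPε : ε • 1 ∈ P)
    (hP : ∀ g, ∀ p ∈ 𝒟 g, p ≠ 0 → (σ p = p ∨ σ p = -p) →
      ∃ d ∈ 𝒟 0, d ≠ 0 ∧ σ d * p * d ∈ P) :
    ∃ (ι : Type) (_ : Fintype ι) (v : ι → V) (s : ι → ι), IsMonomialFamily 𝒱 B P v s ∧
      ∀ x, (∀ a, B (v a) x = 0) → x = 0 := by
  by_contra! hall
  have key : ∀ n : ℕ, ∃ (ι : Type) (_ : Fintype ι) (v : ι → V) (s : ι → ι),
      IsMonomialFamily 𝒱 B P v s ∧ n ≤ Fintype.card ι := by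
    intro n
    induction n with
    | zero =>
      exact ⟨Empty, inferInstance, Empty.elim, id, ⟨fun a => a.elim, fun a => a.elim,
        fun a => a.elim, fun a => a.elim, fun a => a.elim⟩, Nat.zero_le _⟩
    | succ n ih =>
      obtain ⟨ι, hι, v, s, hv, hn⟩ := ih
      obtain ⟨x, hx, hx0⟩ := hall ι hι v s hv
      obtain ⟨κ, hκ, v', s', hv', hlt⟩ := hv.exists_larger hD hV h hP1 hPε hP hx0 hx
      exact ⟨κ, hκ, v', s', hv', by omega⟩
  obtain ⟨ι, hι, v, s, hv, hn⟩ := key (Module.finrank ℝ V + 1)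
  have := hv.linearIndependent.fintype_card_le_finrank
  omega

end Orthogonal

/-! ### Refining the grading on the endomorphism algebra -/

section Refine

variable {D G V : Type*} [Ring D] [Algebra ℝ D] [AddCommGroup G]
  [AddCommGroup V] [Module ℝ V] [Module Dᵐᵒᵖ V] [IsScalarTower ℝ Dᵐᵒᵖ V]
  {𝒟 : G → Submodule ℝ D} {𝒱 : G → Submodule ℝ V}
  {φ : Module.End Dᵐᵒᵖ V →ₗ[ℝ] Module.End Dᵐᵒᵖ V} {σ : D →ₗ[ℝ] D} {B : V →ₗ[ℝ] V →ₗ[ℝ] D}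
  {ε : ℝ} {δ : G}

/-- The expansion of a vector in a basis with monomial Gram matrix. -/
theorem IsMonomialFamily.expand (h : IsHermitianForm 𝒟 𝒱 φ σ B ε δ) {P : Set D}
    {ι : Type*} [Fintype ι] {v : ι → V} {s : ι → ι} (hv : IsMonomialFamily 𝒱 B P v s)
    (hspan : ∀ x, (∀ a, B (v a) x = 0) → x = 0) {q : ι → D}
    (hpq : ∀ a, B (v a) (v (s a)) * q a = 1) (x : V) :
    x = ∑ a, op (q a * B (v a) x) • v (s a) := by
  classical
  refine sub_eq_zero.1 (hspan _ fun b => ?_)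
  rw [map_sub, map_sum, Finset.sum_eq_single b, h.smul_right, ← mul_assoc, hpq, one_mul, sub_self]
  · intro a _ hab
    rw [h.smul_right, hv.eq_zero b (s a), zero_mul]
    intro e
    exact hab (by rw [← hv.involutive a, e, hv.involutive])
  · simp

/-- The grading on `End_D(V)` defined by a grading `C` of `D` and degrees `d a` of the members
`v a` of a basis: `r` has degree `γ` if the matrix entries `B (v a) (r (v b))` have degrees
`γ + (d a + d b - δ)`. -/
def matrixGrading {Γ ι : Type*} [AddCommGroup Γ] (C : Γ → Submodule ℝ D)
    (B : V →ₗ[ℝ] V →ₗ[ℝ] D) (v : ι → V) (d : ι → Γ) (δ : Γ) (γ : Γ) :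
    Submodule ℝ (Module.End Dᵐᵒᵖ V) where
  carrier := {r | ∀ a b, B (v a) (r (v b)) ∈ C (γ + (d a + d b - δ))}
  add_mem' := fun hr hr' a b => by
    rw [LinearMap.add_apply, map_add]
    exact Submodule.add_mem _ (hr a b) (hr' a b)
  zero_mem' := fun a b => by
    rw [LinearMap.zero_apply, map_zero]
    exact Submodule.zero_mem _
  smul_mem' := fun c r hr a b => by
    rw [LinearMap.smul_apply, map_smul]
    exact Submodule.smul_mem _ _ (hr a b)

/-- A refinement of the grading on `D` for which the entries of the monomial Gram matrix of `V` are
homogeneous of suitable degrees extends to a proper refinement of the grading on `End_D(V)` with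
its involution. -/
theorem IsHermitianForm.exists_properRefinement [Nontrivial V] (hD : IsGradedDivision 𝒟)
    (hV : IsRightModuleGrading 𝒟 𝒱) (h : IsHermitianForm 𝒟 𝒱 φ σ B ε δ) {P : Set D}
    {ι Γ : Type*} [Fintype ι] [AddCommGroup Γ] {v : ι → V} {s : ι → ι}
    (hv : IsMonomialFamily 𝒱 B P v s) (hspan : ∀ x, (∀ a, B (v a) x = 0) → x = 0)
    {C : Γ → Submodule ℝ D} (hC : IsAlgebraGrading C) (π : Γ →+ G) (hCD : ∀ γ, C γ ≤ 𝒟 (π γ))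
    (hCσ : PreservesDegree C σ) (hC0 : ∃ x ∈ 𝒟 0, x ∉ C 0) (d : ι → Γ) (δ' : Γ) (hδ : π δ' = δ)
    (hd : ∀ a, v a ∈ 𝒱 (π (d a))) (hp : ∀ a, B (v a) (v (s a)) ∈ C (d a + d (s a) - δ')) :
    IsAlgebraGrading (matrixGrading C B v d δ') ∧ PreservesDegree (matrixGrading C B v d δ') φ ∧
      IsProperRefinement (matrixGrading C B v d δ') (endGrading D 𝒱) := by
  classical
  choose q hqD hpq hqp using fun a => hD.exists_inv (hCD _ (hp a)) (hv.ne_zero a)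
  have hqC : ∀ a, q a ∈ C (-(d a + d (s a) - δ')) := fun a => hC.inv_mem (hp a) (hpq a) (hqp a)
  have hexp := hv.expand h hspan hpq
  have hexp' : ∀ (r : Module.End Dᵐᵒᵖ V) x, r x = ∑ a, op (q a * B (v a) x) • r (v (s a)) := by
    intro r x
    conv_lhs => rw [hexp x]
    rw [map_sum]
    exact Finset.sum_congr rfl fun a _ => map_smul r _ _
  let l : ι → V →ₗ[Dᵐᵒᵖ] D := fun b =>
    { toFun := fun x => q b * B (v b) x
      map_add' := fun x y => by rw [map_add, mul_add]
      map_smul' := fun r x => by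
        rw [RingHom.id_apply, ← op_unop r, h.smul_right, op_smul_eq_mul, mul_assoc] }
  have hl : ∀ b x, l b x = q b * B (v b) x := fun _ _ => rfl
  have hlD : ∀ b k x, x ∈ 𝒱 k → l b x ∈ 𝒟 (k - π (d (s b))) := by
    intro b k x hx
    have h1 := hD.isGrading.mul_mem (hqD b) (h.homogeneous _ _ _ _ (hd b) hx)
    rw [map_sub, map_add, hδ] at h1
    rwa [show -(π (d b) + π (d (s b)) - δ) + (π (d b) + k - δ) = k - π (d (s b)) by abel] at h1
  have hlv : ∀ b, l b (v (s b)) = 1 := fun b => by rw [hl, hqp]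
  have hmem : ∀ γ r, r ∈ matrixGrading C B v d δ' γ ↔
      ∀ a b, B (v a) (r (v b)) ∈ C (γ + (d a + d b - δ')) := fun _ _ => Iff.rfl
  have hgr : IsAlgebraGrading (matrixGrading C B v d δ') := by
    refine ⟨?_, ?_, ?_⟩
    · obtain ⟨R, -, hR1, hR2, -⟩ := exists_projections hC.independent hC.iSup_eq_top
      let L : ι → ι → Module.End Dᵐᵒᵖ V →ₗ[ℝ] D := fun a b =>
        { toFun := fun r => B (v a) (r (v b))
          map_add' := fun r r' => by rw [LinearMap.add_apply, map_add]
          map_smul' := fun c r => by rw [LinearMap.smul_apply, map_smul, RingHom.id_apply] }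
      refine iSupIndep_of_separating (N := ι → ι → D) fun γ =>
        ⟨LinearMap.pi fun a => LinearMap.pi fun b => R (γ + (d a + d b - δ')) ∘ₗ L a b,
          fun r hr h0 => ?_, fun γ' hγ r hr => ?_⟩
      · have h1 : ∀ b, r (v b) = 0 := fun b => hspan _ fun a => by
          have h2 := congrFun (congrFun h0 a) b
          change R _ (B (v a) (r (v b))) = 0 at h2
          rwa [hR1 _ _ (hr a b)] at h2
        refine LinearMap.ext fun x => ?_
        rw [hexp' r x]
        exact Finset.sum_eq_zero fun a _ => by rw [h1, smul_zero]
      · funext a b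
        exact hR2 _ _ _ (hr a b) fun e => hγ (add_right_cancel e).symm
    · rw [eq_top_iff]
      have h1 : ∀ (b a : ι) (t : D), rankOne (l b) (op t • v (s a)) ∈
          ⨆ γ, matrixGrading C B v d δ' γ := by
        intro b a t
        refine induction_of_iSup_eq_top hC.iSup_eq_top (p := fun t =>
          rankOne (l b) (op t • v (s a)) ∈ ⨆ γ, matrixGrading C B v d δ' γ) (fun k t ht => ?_)
          (by rw [op_zero, zero_smul, map_zero]; exact Submodule.zero_mem _)
          (fun x y hx hy => by
            rw [op_add, add_smul, map_add]
            exact Submodule.add_mem _ hx hy) t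
        refine Submodule.mem_iSup_of_mem (k + d (s a) - d (s b)) ?_
        intro a' b'
        rw [rankOne_apply, h.smul_right, h.smul_right, hl]
        by_cases ha : s a = s a'
        · have ha' : a = a' := by rw [← hv.involutive a, ha, hv.involutive]
          subst ha'
          by_cases hb : b' = s b
          · subst hb
            rw [hqp, mul_one]
            have h1 := hC.mul_mem (hp a) ht
            rwa [show d a + d (s a) - δ' + k = k + d (s a) - d (s b) + (d a + d (s b) - δ') by
              abel] at h1
          · rw [hv.eq_zero _ _ hb, mul_zero, mul_zero]
            exact Submodule.zero_mem _
        · rw [hv.eq_zero _ _ ha, zero_mul, zero_mul]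
          exact Submodule.zero_mem _
      intro r _
      have h2 : r = ∑ b, rankOne (l b) (r (v (s b))) := by
        refine LinearMap.ext fun x => ?_
        rw [LinearMap.sum_apply, hexp' r x]
        rfl
      rw [h2]
      refine Submodule.sum_mem _ fun b _ => ?_
      rw [hexp (r (v (s b))), map_sum]
      exact Submodule.sum_mem _ fun a _ => h1 _ _ _
    · intro γ γ' r r' hr hr' a b
      rw [Module.End.mul_apply, hexp' r, map_sum]
      refine Submodule.sum_mem _ fun c _ => ?_
      rw [h.smul_right]
      have h1 := hC.mul_mem (hr a (s c)) (hC.mul_mem (hqC c) (hr' c b))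
      rwa [show γ + (d a + d (s c) - δ') + (-(d c + d (s c) - δ') + (γ' + (d c + d b - δ'))) =
        γ + γ' + (d a + d b - δ') by abel] at h1
  have href : ∀ γ, matrixGrading C B v d δ' γ ≤ endGrading D 𝒱 (π γ) := by
    intro γ r hr
    have h1 : ∀ b, r (v (s b)) ∈ 𝒱 (π γ + π (d (s b))) := by
      intro b
      rw [hexp (r (v (s b)))]
      refine Submodule.sum_mem _ fun a _ => ?_
      have h2 := hV.smul_mem (hd (s a)) (hD.isGrading.mul_mem (hqD a) (hCD _ (hr a (s b))))
      simp only [map_add, map_sub] at h2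
      rwa [show π (d (s a)) + (-(π (d a) + π (d (s a)) - π δ') +
        (π γ + (π (d a) + π (d (s b)) - π δ'))) = π γ + π (d (s b)) by abel] at h2
    intro k x hx
    rw [hexp' r x]
    refine Submodule.sum_mem _ fun b _ => ?_
    have h2 := hV.smul_mem (h1 b) (hlD b k x hx)
    rwa [show π γ + π (d (s b)) + (k - π (d (s b))) = π γ + k by abel] at h2
  refine ⟨hgr, ?_, fun γ => ⟨_, href γ⟩, 0, 0, ?_, ?_⟩
  · intro γ r hr a b
    rw [← h.adjoint, h.hermitian (v b)]
    refine Submodule.smul_mem _ _ (hCσ _ _ ?_)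
    rw [add_comm (d a)]
    exact hr b a
  · exact (Submodule.ne_bot_iff _).2 ⟨1, hgr.one_mem, one_ne_zero⟩
  · obtain ⟨b⟩ : Nonempty ι := by
      by_contra hι
      rw [not_nonempty_iff] at hι
      obtain ⟨x, hx⟩ := exists_ne (0 : V)
      exact hx (hspan x fun a => hι.elim a)
    obtain ⟨x, hx, hxC⟩ := hC0
    refine lt_of_le_not_ge (by simpa using href 0) fun hle => hxC ?_
    have h1 := rankOne_mem_endGrading hV (hlD b) (hV.smul_mem (hd (s b)) hx)
    rw [add_zero, sub_self] at h1
    have h2 := hle h1 b (s b)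
    rw [rankOne_apply, hlv, op_one, one_smul, h.smul_right] at h2
    have h3 := hC.mul_mem (hqC b) h2
    rwa [← mul_assoc, hqp, one_mul, zero_add, neg_add_cancel] at h3

end Refine

/-! ### Changing the grading group -/

section GradingGroups

universe u w

/-- The grading group of a refinement of a grading on a finite-dimensional algebra can be taken in
any universe, because only its finitely generated subgroup generated by the support matters. -/
theorem IsFineWithInvolution.not_isProperRefinement {F : Type*} [Field F] {G : Type u}
    [AddCommGroup G] {A : Type*} [Ring A] [Algebra F A] [FiniteDimensional F A] {φ : A →ₗ[F] A}
    {𝒜 : G → Submodule F A} (h : IsFineWithInvolution φ 𝒜) {Γ : Type w} [AddCommGroup Γ]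
    {ℛ : Γ → Submodule F A} (hR : IsAlgebraGrading ℛ) (hφ : PreservesDegree ℛ φ) :
    ¬ IsProperRefinement ℛ 𝒜 := by
  rintro ⟨hr, γ₀, g, hγ₀, hlt⟩
  have hfin : {γ | ℛ γ ≠ ⊥}.Finite := WellFoundedGT.finite_ne_bot_of_iSupIndep hR.independent
  let K : Submodule ℤ Γ := Submodule.span ℤ {γ | ℛ γ ≠ ⊥}
  have : Module.Finite ℤ K := Module.Finite.span_of_finite ℤ hfin
  have : Countable K := by
    obtain ⟨n, f, hf⟩ := Module.Finite.exists_fin' ℤ K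
    exact hf.countable
  have hsmall : Small.{u} K := Countable.toSmall.{u} K
  obtain ⟨S, _, ⟨e⟩⟩ : ∃ (S : Type u) (_ : AddCommGroup S), Nonempty (S ≃+ K) :=
    ⟨@Shrink.{u} K hsmall, inferInstance, ⟨@Shrink.addEquiv.{u} K hsmall _⟩⟩
  have hsupp : ∀ γ, ℛ γ ≠ ⊥ → ∃ k : S, (e k : Γ) = γ := fun γ hγ =>
    ⟨e.symm ⟨γ, Submodule.subset_span hγ⟩, by simp⟩
  refine h S (fun k => ℛ (e k)) ⟨?_, ?_, ?_⟩ (fun k x hx => hφ _ x hx) ⟨fun k => hr _, ?_⟩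
  · exact hR.independent.comp (Subtype.val_injective.comp e.injective)
  · rw [eq_top_iff, ← hR.iSup_eq_top]
    refine iSup_le fun γ => ?_
    by_cases hγ : ℛ γ = ⊥
    · rw [hγ]; exact bot_le
    · obtain ⟨k, rfl⟩ := hsupp γ hγ
      exact le_iSup (fun k : S => ℛ (e k)) k
  · intro k k' x y hx hy
    rw [map_add]
    exact hR.mul_mem hx hy
  · obtain ⟨k, rfl⟩ := hsupp γ₀ hγ₀
    exact ⟨k, g, hγ₀, hlt⟩

/-- Each abelian group embeds into one in which all elements can be halved. -/
theorem exists_injective_halvable (H : Type w) [AddCommGroup H] :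
    ∃ (K : Type w) (_ : AddCommGroup K) (j : H →+ K) (half : K → K), Function.Injective j ∧
      ∀ x, half x + half x = x := by
  have hdiv : ∀ x : AddCircle (1 : ℚ), ∃ y, y + y = x := by
    intro x
    induction x using QuotientAddGroup.induction_on with | H x =>
    refine ⟨((x / 2 : ℚ) : AddCircle (1 : ℚ)), ?_⟩
    rw [← QuotientAddGroup.mk_add, add_halves]
  choose half hhalf using hdiv
  refine ⟨CharacterModule H → AddCircle (1 : ℚ), inferInstance,
    { toFun := fun x c => c x
      map_zero' := funext fun c => map_zero c
      map_add' := fun x y => funext fun c => map_add c x y }, fun x c => half (x c), ?_,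
    fun x => funext fun c => hhalf _⟩
  rw [injective_iff_map_eq_zero]
  intro x hx
  by_contra h0
  obtain ⟨c, hc⟩ := CharacterModule.exists_character_apply_ne_zero_of_ne_zero h0
  exact hc (congrFun hx c)

end GradingGroups

/-! ### Fine gradings -/

section Main

variable {D G H V : Type*} [Ring D] [Algebra ℝ D] [AddCommGroup G] [AddCommGroup H]
  [AddCommGroup V] [Module ℝ V] [Module Dᵐᵒᵖ V] [IsScalarTower ℝ Dᵐᵒᵖ V]
  {𝒟 : G → Submodule ℝ D} {𝒱 : G → Submodule ℝ V}
  {φ : Module.End Dᵐᵒᵖ V →ₗ[ℝ] Module.End Dᵐᵒᵖ V} {σ : D →ₗ[ℝ] D} {B : V →ₗ[ℝ] V →ₗ[ℝ] D}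
  {ε : ℝ} {δ : G}

/-- An adapted refinement of the grading on `D` yields a proper refinement of the grading on
`End_D(V)` with involution. -/
theorem IsFineWithInvolution.not_isAdaptedRefinement [FiniteDimensional ℝ V] [Nontrivial V]
    (hfine : IsFineWithInvolution φ (endGrading D 𝒱)) (hD : IsGradedDivision 𝒟)
    (hV : IsRightModuleGrading 𝒟 𝒱) (h : IsHermitianForm 𝒟 𝒱 φ σ B ε δ)
    {C : H × G → Submodule ℝ D} (hC : IsAdaptedRefinement 𝒟 σ C) : False := by
  obtain ⟨ι, _, v, s, hv, hspan⟩ := h.exists_monomial_basis hD hV (P := {p | ∃ k, p ∈ C k})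
    ⟨0, hC.isGrading.one_mem⟩ ⟨0, (C 0).smul_mem _ hC.isGrading.one_mem⟩ hC.adapted
  choose deg hdeg using hv.homogeneous
  choose τ hτ using hv.mem
  have hτs : ∀ a, τ (s a) = τ a := by
    intro a
    by_contra hne
    have h1 : B (v (s a)) (v (s (s a))) ∈ C (τ a) := by
      rw [hv.involutive, h.hermitian (v a)]
      exact (C _).smul_mem _ (hC.invariant _ _ (hτ a))
    exact hv.ne_zero (s a) (eq_zero_of_iSupIndep hC.isGrading.independent hne (hτ (s a)) h1)
  have hτ2 : ∀ a, (τ a).2 = deg a + deg (s a) - δ := by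
    intro a
    by_contra hne
    exact hv.ne_zero a (eq_zero_of_iSupIndep hD.isGrading.independent hne (hC.le _ (hτ a))
      (h.homogeneous _ _ _ _ (hdeg a) (hdeg (s a))))
  obtain ⟨K, _, j, half, hj, hhalf⟩ := exists_injective_halvable H
  let f : H × G →+ K × G := AddMonoidHom.prodMap j (AddMonoidHom.id G)
  have hf : Function.Injective f := Function.Injective.prodMap hj Function.injective_id
  have hCσ : PreservesDegree (fun k : K × G => ⨆ (g : H × G) (_ : f g = k), C g) σ := by
    intro k x hx
    have h1 : ⨆ (g : H × G) (_ : f g = k), C g ≤ (⨆ (g : H × G) (_ : f g = k), C g).comap σ :=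
      iSup₂_le fun g hg x hx =>
        (le_iSup₂_of_le (f := fun (g : H × G) (_ : f g = k) => C g) g hg le_rfl)
          (hC.invariant g x hx)
    exact h1 hx
  have hle : ∀ k : K × G, ⨆ (g : H × G) (_ : f g = k), C g ≤ 𝒟 (AddMonoidHom.snd K G k) := by
    intro k
    refine iSup₂_le fun g hg => ?_
    rw [← hg]
    exact hC.le g
  have hC0 : ∃ x ∈ 𝒟 0, x ∉ ⨆ (g : H × G) (_ : f g = 0), C g := by
    obtain ⟨x, hx, hxC⟩ := hC.proper
    refine ⟨x, hx, fun h0 => hxC ?_⟩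
    have h1 : ⨆ (g : H × G) (_ : f g = 0), C g ≤ C 0 :=
      iSup₂_le fun g hg => by rw [hf (hg.trans (map_zero f).symm)]
    exact h1 h0
  -- `v a` gets half of the degree `τ a` in the first component; since `τ (s a) = τ a`, the degrees
  -- of `v a` and `v (s a)` add up to `τ a`
  obtain ⟨h1, h2, h3⟩ := h.exists_properRefinement hD hV hv hspan (hC.isGrading.pushforward f hf)
    (AddMonoidHom.snd K G) hle hCσ hC0 (fun a => (half (j (τ a).1), deg a)) (0, δ) rfl hdeg
    (fun a => by
      have h4 : ((half (j (τ a).1), deg a) + (half (j (τ (s a)).1), deg (s a)) - (0, δ) : K × G) =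
          f (τ a) := by
        refine Prod.ext ?_ ?_
        · change half (j (τ a).1) + half (j (τ (s a)).1) - 0 = j (τ a).1
          rw [hτs, hhalf, sub_zero]
        · exact (hτ2 a).symm
      rw [h4]
      exact (le_iSup₂_of_le (f := fun (g : H × G) (_ : f g = f (τ a)) => C g) (τ a) rfl le_rfl)
        (hτ a))
  have : FiniteDimensional ℝ (Module.End Dᵐᵒᵖ V) :=
    Module.Finite.of_injective (LinearMap.restrictScalarsₗ ℝ Dᵐᵒᵖ V V ℝ)
      (LinearMap.restrictScalars_injective ℝ)
  exact hfine.not_isProperRefinement h1 h2 h3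

/-- If the identity component of a division grading is central and refines to real lines, then
homogeneous elements commute up to real factors. -/
theorem IsRefinement.commute_up_to_real [FiniteDimensional ℝ D] {ℬ : H → Submodule ℝ D}
    (hD : IsGradedDivision 𝒟) (hB : IsAlgebraGrading ℬ) (hr : IsRefinement ℬ 𝒟)
    (hR : ∀ x ∈ ℬ 0, ∃ r : ℝ, x = algebraMap ℝ D r) {J : D} (hJD : J ∈ 𝒟 0) (hJ : J * J = -1)
    (hJc : ∀ x, J * x = x * J) (g k : G) (x : D) (hx : x ∈ 𝒟 g) (y : D) (hy : y ∈ 𝒟 k) :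
    ∃ r : ℝ, y * x = r • (x * y) := by
  obtain ⟨P, hP, -, -, hs, hPg⟩ :=
    hr.exists_projections hB.independent hB.iSup_eq_top hD.isGrading.independent
  have hcen : ∀ c ∈ 𝒟 0, ∀ z, c * z = z * c := by
    intro c hc z
    obtain ⟨a, b, rfl⟩ := hD.exists_eq_add_smul hJD hJ (fun x _ => hJc x) hc
    rw [add_mul, mul_add, Algebra.commutes, smul_mul_assoc, hJc, mul_smul_comm]
  have hcomp : ∀ {g : G} {x : D}, x ∈ 𝒟 g → x ≠ 0 → ∃ i, ∃ z ∈ ℬ i, z ∈ 𝒟 g ∧ z ≠ 0 ∧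
      ∃ c ∈ 𝒟 0, x = c * z := by
    intro g x hx hx0
    obtain ⟨i, hi⟩ : ∃ i, P i x ≠ 0 := by
      by_contra! hall
      obtain ⟨t, ht⟩ := hs x
      exact hx0 (by rw [ht]; exact Finset.sum_eq_zero fun i _ => hall i)
    obtain ⟨y, hy, -, hyx⟩ := hD.exists_inv (hPg g i x hx) hi
    have h1 := hD.isGrading.mul_mem hx hy
    rw [add_neg_cancel] at h1
    exact ⟨i, P i x, hP i x, hPg g i x hx, hi, x * y, h1, by rw [mul_assoc, hyx, mul_one]⟩
  by_cases hx0 : x = 0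
  · exact ⟨0, by rw [hx0, mul_zero, zero_mul, smul_zero]⟩
  by_cases hy0 : y = 0
  · exact ⟨0, by rw [hy0, mul_zero, zero_mul, smul_zero]⟩
  obtain ⟨i, X, hX, hXD, hX0, c, hc, rfl⟩ := hcomp hx hx0
  obtain ⟨k, Y, hY, hYD, hY0, c', hc', rfl⟩ := hcomp hy hy0
  have h1 := hB.mul_mem hY hX
  rw [add_comm] at h1
  obtain ⟨r, hr⟩ := hr.exists_eq_smul hD hB hR (hB.mul_mem hX hY) (hD.mul_ne_zero hXD hX0 hY0) h1
  refine ⟨r, ?_⟩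
  calc c' * Y * (c * X) = c' * (Y * c) * X := by simp only [mul_assoc]
    _ = c' * c * (Y * X) := by rw [← hcen c hc Y]; simp only [mul_assoc]
    _ = r • (c * (c' * X) * Y) := by
      rw [hr, hcen c' hc' c, mul_smul_comm]; simp only [mul_assoc]
    _ = r • (c * X * (c' * Y)) := by rw [hcen c' hc' X]; simp only [mul_assoc]

end Main

end GradedInv

theorem mainTheorem10 {G : Type*} [AddCommGroup G]
    {D : Type*} [Ring D] [Algebra ℝ D] [FiniteDimensional ℝ D]
    (𝒟 : G → Submodule ℝ D) (hD : GradedInv.IsGradedDivision 𝒟)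
    {V : Type*} [AddCommGroup V] [Module ℝ V] [Module Dᵐᵒᵖ V] [IsScalarTower ℝ Dᵐᵒᵖ V]
    [Module.Finite Dᵐᵒᵖ V] [Nontrivial V]
    (𝒱 : G → Submodule ℝ V) (hV : GradedInv.IsRightModuleGrading 𝒟 𝒱)
    (φ : Module.End Dᵐᵒᵖ V →ₗ[ℝ] Module.End Dᵐᵒᵖ V) (hφ : GradedInv.IsInvolution φ)
    (hφdeg : GradedInv.PreservesDegree (GradedInv.endGrading D 𝒱) φ)
    (hcs : GradedInv.IsCentralSimpleWithInvolution φ)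
    (hfine : GradedInv.IsFineWithInvolution φ (GradedInv.endGrading D 𝒱)) :
    GradedInv.IsFine 𝒟 := by
  intro H _ ℬ hB hproper
  have := hD.nontrivial
  have : Module.Finite ℝ Dᵐᵒᵖ := Module.Finite.equiv (MulOpposite.opLinearEquiv ℝ)
  have : FiniteDimensional ℝ V := Module.Finite.trans Dᵐᵒᵖ V
  obtain ⟨σ, B, ε, δ, h⟩ := GradedInv.exists_isHermitianForm hD hV hφ hφdeg
  by_cases hnc : ∃ x ∈ 𝒟 0, ∃ y ∈ 𝒟 0, x * y ≠ y * x
  · obtain ⟨C, hC⟩ := hD.exists_adapted_of_noncomm hnc h.involution h.preservesDegree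
    exact hfine.not_isAdaptedRefinement hD hV h hC
  -- the identity component is commutative; it is `ℝ + ℝ J`, and it is refined to `ℝ`
  push Not at hnc
  have hne := hproper.exists_not_mem_zero hD hB
  have hr := hproper.1
  obtain ⟨x, hx, hxB⟩ := hne
  obtain ⟨J, hJD, hJ⟩ : ∃ J ∈ 𝒟 0, J * J = -1 := by
    rcases hD.real_or_imaginary hx with ⟨r, rfl⟩ | ⟨-, -, J, -, hJD, hJ, -⟩
    · exact absurd (hB.algebraMap_mem r) hxB
    · exact ⟨J, hJD, hJ⟩
  have hc : ∀ x ∈ 𝒟 0, J * x = x * J := fun x hx => hnc J hJD x hx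
  have hR := hr.zero_real hD hB ⟨x, hx, hxB⟩ hJD hJ hc
  by_cases hJc : ∃ x, x * J ≠ J * x
  · obtain ⟨k, hJk⟩ := hr.exists_imaginary_mem hD hB hR hJD hJ hc
    obtain ⟨C, hC⟩ := hr.exists_adapted_of_not_central hD hJD hJ hc hJc h.involution
      h.preservesDegree hB hR hJk
    exact hfine.not_isAdaptedRefinement hD hV h hC
  · -- a symmetric `J` would be a symmetric central element that is not real
    push Not at hJc
    have hJc' : ∀ x, J * x = x * J := fun x => (hJc x).symm
    have hσJ : σ J = -J := by
      have h1 : σ J * σ J = -1 := by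
        rw [← h.involution.map_mul, hJ, map_neg, h.involution.map_one]
      refine (hD.eq_or_eq_neg_of_commute hJD (h.preservesDegree 0 J hJD) hJ h1
        (hJc' _)).resolve_left fun e => ?_
      obtain ⟨r, hr⟩ := h.central hD hcs.central hJD hJc' e
      exact GradedInv.not_real_of_sq_eq_neg_one hJ r hr
    obtain ⟨Q, _, C, hC⟩ := hD.exists_adapted_of_central hJD hJ hJc' h.involution
      h.preservesDegree hσJ (hr.commute_up_to_real hD hB hR hJD hJ hJc')
    exact hfine.not_isAdaptedRefinement hD hV h hC
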